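/- Let $\mathcal Z=(\mathcal L,\mathcal R):\mathbb Z\to\mathbb Z^2$ be a bi-infinite random walk with $\mathcal Z_0=0$ and i.i.d. increments uniform on $\{(1,0),(0,-1),(-1,1)\}$. Let $(G,\mathcal O,\mathbf e)$ be the uniform infinite bipolar-oriented triangulation encoded by $\mathcal Z$, with exploration path $\lambda':\mathbb Z\to E(G)$, $\lambda'(0)=\mathbf e$. That is, $G$ is the oriented triangulation, drawn with all edges pointing upward, that is obtained from $\mathcal Z$ by the following sewing procedure. * If $\mathcal Z_{n+1}-\mathcal Z_n=(-1,1)$, then $\lambda'(n+1)$ starts at the top of $\lambda'(n)$. * If $\mathcal Z_{n+1}-\mathcal Z_n=(1,0)$, then there is a triangular face with left side $\lambda'(n)$ and right side (from bottom to top) $\lambda'(n+1),\lambda'(k)$, where $k$ is the first time after $n$ at which $\mathcal L_k=\mathcal L_n$. * If $\mathcal Z_{n+1}-\mathcal Z_n=(0,-1)$, then there is a triangular face with left side (from bottom to top) $\lambda'(j),\lambda'(n)$ and right side $\lambda'(n+1)$, where $j$ is the last time before $n+1$ at which $\mathcal R_j=\mathcal R_{n+1}$. The vertices of $G$ are the end-points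 of edges up to the identifications that these rules impose. For $i\in\mathbb Z$, the west-going flow line $\lambda^W_i$ starts with $\lambda'(i)$, and each of its edges is followed by the leftmost edge that goes up from its top. The east-going flow line $\lambda_i^E$ starts with $\lambda'(i)$, and each of its edges is followed by the rightmost edge that leads up to its bottom. Together they form the outer boundary of $\lambda'((-\infty,i])$ and of $\lambda'([i,\infty))$; the edges visited from time $i$ on (resp. up to time $i$) together with this boundary form the future (resp. past) half-plane at time $i$. The north-going flow line $\lambda_i^N$ is the dual path that starts by crossing $\lambda'(i)$ from left to right and that always leaves a face through the highest edge of the right side of the face. The south-going flow line $\lambda_i^S$ starts by crossing $\lambda'(i)$ from right to left and always leaves a face through the lowest edge of the left side of the face. The path $\lambda_i^N$ (resp. $\lambda_i^S$) divides the future (resp. past) half-plane at time $i$ into a west side, containing the top of $\lambda'(i)$, and an east side, containing the bottom of $\lambda'(i)$; two vertices are on the same side when they are joined by edges of this half-plane that the path does not cross. An edge is to the west of the flow line if both of its end-points are on the west side, and to the east if at least one of its end-points is on the east side. For $i_1<i_2$ let $F^N_{i_1,i_2}$ be the event that the edge of $\lambda^N_{i_1}$ which crosses the outer boundary of $\lambda'((-\infty,i_2])$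 lies on $\lambda^E_{i_2}$, and let $F^S_{i_1,i_2}$ be the event that the edge of $\lambda^S_{i_2}$ which crosses the outer boundary of $\lambda'([i_1,\infty))$ lies on $\lambda^E_{i_1}$. On $F^N_{i_1,i_2}$ (resp. its complement) let $M^N_{i_1,i_2}$ be the set of the edges in $\lambda'([i_2,\infty))$ that are to the west (resp. east) of $\lambda^N_{i_1}$ and to the east (resp. west) of $\lambda^N_{i_2}$. On $F^S_{i_1,i_2}$ (resp. its complement) let $M^S_{i_1,i_2}$ be the set of the edges in $\lambda'((-\infty,i_1])$ that are to the west (resp. east) of $\lambda^S_{i_2}$ and to the east (resp. west) of $\lambda^S_{i_1}$. Put $M^N_{i,i}=M^S_{i,i}=\emptyset$. **Proposition.** Let $s_1<s_2$ be real numbers. For every integer $m\ge 1$ the sets $M^N_{\lfloor s_1m\rfloor,\lfloor s_2m\rfloor}$ and $M^S_{\lfloor s_1m\rfloor,\lfloor s_2m\rfloor}$ are almost surely finite, their cardinalities are random variables, and the laws of the families $$\{m^{-1}\,\# M^N_{\lfloor s_1m\rfloor,\lfloor s_2m\rfloor}\}_{m\ge1}\quad\text{and}\quad \{m^{-1}\,\#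 M^S_{\lfloor s_1m\rfloor,\lfloor s_2m\rfloor}\}_{m\ge1}$$ are tight. -/

import Mathlib

open MeasureTheory ProbabilityTheory

/-! Conventions.  The oriented triangulation is drawn so that every edge points upward.
The compass is rotated: north = up-right, west = up-left, south = down-left, east = down-right.
The edge visited at time `n` by the space-filling exploration path is called `n`, so the
edge set of the map is `ℤ`, the exploration path is the identity, and the root edge is `0`. -/

namespace BipolarMap

/-- `Z` is a bi-infinite random walk started from `0` at time `0` whose increments are
independent and uniformly distributed on `{(1,0), (0,-1), (-1,1)}`. -/
structure IsEncodingWalk {Ω : Type*} [MeasurableSpace Ω] (P : Measure Ω)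
    (Z : ℤ → Ω → ℤ × ℤ) : Prop where
  measurable : ∀ n, Measurable (Z n)
  start : ∀ ω, Z 0 ω = 0
  indep : iIndepFun (fun (n : ℤ) (ω : Ω) => Z (n + 1) ω - Z n ω) P
  uniform : ∀ n : ℤ, ∀ v ∈ ({(1, 0), (0, -1), (-1, 1)} : Finset (ℤ × ℤ)),
    P {ω | Z (n + 1) ω - Z n ω = v} = 1 / 3

/-! ### The sewing procedure

At time `n` the right boundary of the explored part of the map consists of the active edge `n`,
of a stack of explored edges below it, and of a stack of missing edges above it (edges that are
already on the boundary of an explored face and get their names when they are visited).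
* Step `(-1,1)`: the new edge `n + 1` goes up from the top of edge `n`; it fills the lowest missing
  edge (pop), and `n` is pushed on the lower stack.
* Step `(1,0)`: a triangle with `n` on its left is sewn on; on its right are `n + 1` and above it
  a new missing edge (push).
* Step `(0,-1)`: a triangle is sewn on that has on its left `n` and below it the first edge of the
  lower stack (pop), and on its right `n + 1`.
-/

/-- `IsFace Z l r`: a face of the map with edges `l` on its left side and `r` on its right side,
both listed from bottom to top. -/
inductive IsFace (Z : ℤ → ℤ × ℤ) : List ℤ → List ℤ → Prop
  /-- The missing edge pushed at step `n` is filled at the first time `k > n` at which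
  the first coordinate is back at its value at time `n`. -/
  | push (n k : ℤ) (hstep : Z (n + 1) - Z n = (1, 0)) (hnk : n < k) (hk : (Z k).1 = (Z n).1)
      (hmin : ∀ j, n < j → j < k → (Z n).1 < (Z j).1) : IsFace Z [n] [n + 1, k]
  /-- The first edge of the lower stack is the last `j ≤ n` at which the second
  coordinate had the value that it has at time `n + 1`. -/
  | pop (n j : ℤ) (hstep : Z (n + 1) - Z n = (0, -1)) (hjn : j < n + 1)
      (hj : (Z j).2 = (Z (n + 1)).2)
      (hmin : ∀ i, j < i → i < n + 1 → (Z (n + 1)).2 < (Z i).2) : IsFace Z [j, n] [n + 1]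

/-- The two ends of an edge: its bottom (initial) end and its top (terminal) end. -/
inductive EdgeEnd
  | bot (e : ℤ)
  | top (e : ℤ)

/-- The identifications of edge ends made by the sewing procedure: a step `(-1,1)` glues the new
edge on top of the previous one, and around each face the edges of a side follow one
another and the two sides have the same lowest and the same highest point. -/
inductive Glue (Z : ℤ → ℤ × ℤ) : EdgeEnd → EdgeEnd → Prop
  | edge (n : ℤ) (hstep : Z (n + 1) - Z n = (-1, 1)) : Glue Z (.top n) (.bot (n + 1))
  | left {l r : List ℤ} {a b : ℤ} (hf : IsFace Z l r) (hab : [a, b] <:+: l) :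
      Glue Z (.top a) (.bot b)
  | right {l r : List ℤ} {a b : ℤ} (hf : IsFace Z l r) (hab : [a, b] <:+: r) :
      Glue Z (.top a) (.bot b)
  | lowest {l r : List ℤ} {a b : ℤ} (hf : IsFace Z l r) (ha : l.head? = some a)
      (hb : r.head? = some b) : Glue Z (.bot a) (.bot b)
  | highest {l r : List ℤ} {a b : ℤ} (hf : IsFace Z l r) (ha : l.getLast? = some a)
      (hb : r.getLast? = some b) : Glue Z (.top a) (.top b)

/-- The vertices of the map. -/
def Vertex (Z : ℤ → ℤ × ℤ) : Type := Quot (Glue Z)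

/-- The lower (initial) vertex of the edge `e`. -/
def botV (Z : ℤ → ℤ × ℤ) (e : ℤ) : Vertex Z := Quot.mk _ (.bot e)

/-- The upper (terminal) vertex of the edge `e`. -/
def topV (Z : ℤ → ℤ × ℤ) (e : ℤ) : Vertex Z := Quot.mk _ (.top e)

/-! ### Flow lines -/

/-- `e'` is the leftmost edge that goes up from the top of `e`: no face has its lowest vertex
at the bottom of `e'` and `e'` on its right side (such a face would separate `e'` from
a further outgoing edge on its left). -/
def WStep (Z : ℤ → ℤ × ℤ) (e e' : ℤ) : Prop :=
  topV Z e = botV Z e' ∧ ¬ ∃ l r, IsFace Z l r ∧ r.head? = some e'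

/-- `e'` is the rightmost edge that comes up to the bottom of `e`: no face has its highest
vertex at the top of `e'` and `e'` on its left side. -/
def EStep (Z : ℤ → ℤ × ℤ) (e e' : ℤ) : Prop :=
  botV Z e = topV Z e' ∧ ¬ ∃ l r, IsFace Z l r ∧ l.getLast? = some e'

/-- The dual edge of `e` joins the faces to the right and to the left of `e`. The north-going
tree of the dual map leaves the face to the right of `e` through the highest edge of
the right side of that face. Dual edges are named by the edges that they cross. -/
def NStep (Z : ℤ → ℤ × ℤ) (e e' : ℤ) : Prop :=
  ∃ l r, IsFace Z l r ∧ e ∈ l ∧ r.getLast? = some e'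

/-- The south-going tree of the dual map leaves the face to the left of `e` through the lowest
edge of the left side of that face. -/
def SStep (Z : ℤ → ℤ × ℤ) (e e' : ℤ) : Prop :=
  ∃ l r, IsFace Z l r ∧ e ∈ r ∧ l.head? = some e'

/-- The edges of the west-going flow line started from the edge `i`. -/
def westLine (Z : ℤ → ℤ × ℤ) (i : ℤ) : Set ℤ := {e | Relation.ReflTransGen (WStep Z) i e}

/-- The edges of the east-going flow line started from the edge `i`. -/
def eastLine (Z : ℤ → ℤ × ℤ) (i : ℤ) : Set ℤ := {e | Relation.ReflTransGen (EStep Z) i e}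

/-- The edges crossed by the north-going (dual) flow line started from the edge `i`. -/
def northLine (Z : ℤ → ℤ × ℤ) (i : ℤ) : Set ℤ := {e | Relation.ReflTransGen (NStep Z) i e}

/-- The edges crossed by the south-going (dual) flow line started from the edge `i`. -/
def southLine (Z : ℤ → ℤ × ℤ) (i : ℤ) : Set ℤ := {e | Relation.ReflTransGen (SStep Z) i e}

/-! ### Sides of the north-going and south-going flow lines

The west-going and east-going flow lines from `i` separate the map into a past half-plane and
a future half-plane. The north-going flow line from `i` starts by crossing `i` from left to right,
stays in the future half-plane and cuts it into two pieces: the west piece, which has the top of `i`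
on its boundary, and the east piece, which has the bottom of `i` on its boundary. Two vertices
are in the same piece when they are joined by edges that the flow line does not cross. The
south-going flow line does the same in the past half-plane. -/

/-- The vertices `u`, `v` are joined by a path of edges from `A`. -/
def Joined (Z : ℤ → ℤ × ℤ) (A : Set ℤ) (u v : Vertex Z) : Prop :=
  Relation.EqvGen (fun x y => ∃ e ∈ A, x = botV Z e ∧ y = topV Z e) u v

/-- The edges visited from time `i` on, and those on the outer boundary at time `i`. -/
def future (Z : ℤ → ℤ × ℤ) (i : ℤ) : Set ℤ := Set.Ici i ∪ (westLine Z i ∪ eastLine Z i)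

/-- The edges visited up to time `i`, and those on the outer boundary at time `i`. -/
def past (Z : ℤ → ℤ × ℤ) (i : ℤ) : Set ℤ := Set.Iic i ∪ (westLine Z i ∪ eastLine Z i)

/-- The vertices on the west side of the north-going flow line from `i`. -/
def northWestV (Z : ℤ → ℤ × ℤ) (i : ℤ) : Set (Vertex Z) :=
  {v | Joined Z (future Z i \ northLine Z i) (topV Z i) v}

/-- The vertices on the east side of the north-going flow line from `i`. -/
def northEastV (Z : ℤ → ℤ × ℤ) (i : ℤ) : Set (Vertex Z) :=
  {v | Joined Z (future Z i \ northLine Z i) (botV Z i) v}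

/-- The vertices on the west side of the south-going flow line from `i`. -/
def southWestV (Z : ℤ → ℤ × ℤ) (i : ℤ) : Set (Vertex Z) :=
  {v | Joined Z (past Z i \ southLine Z i) (topV Z i) v}

/-- The vertices on the east side of the south-going flow line from `i`. -/
def southEastV (Z : ℤ → ℤ × ℤ) (i : ℤ) : Set (Vertex Z) :=
  {v | Joined Z (past Z i \ southLine Z i) (botV Z i) v}

/-- An edge is to the west of a flow line if both of its end-points are. -/
def bothEnds (Z : ℤ → ℤ × ℤ) (W : Set (Vertex Z)) : Set ℤ := {e | botV Z e ∈ W ∧ topV Z e ∈ W}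

/-- An edge is to the east of a flow line if at least one of its end-points is. -/
def someEnd (Z : ℤ → ℤ × ℤ) (W : Set (Vertex Z)) : Set ℤ := {e | botV Z e ∈ W ∨ topV Z e ∈ W}

/-! ### The regions between two flow lines -/

/-- The edge of the north-going flow line from `i₁` that crosses the outer boundary
(`westLine Z i₂ ∪ eastLine Z i₂`) of the past at time `i₂` lies on `eastLine Z i₂`. -/
def FN (Z : ℤ → ℤ × ℤ) (i₁ i₂ : ℤ) : Prop := (northLine Z i₁ ∩ eastLine Z i₂).Nonempty

/-- The edge of the south-going flow line from `i₂` that crosses the outer boundary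
(`westLine Z i₁ ∪ eastLine Z i₁`) of the future at time `i₁` lies on `eastLine Z i₁`. -/
def FS (Z : ℤ → ℤ × ℤ) (i₁ i₂ : ℤ) : Prop := (southLine Z i₂ ∩ eastLine Z i₁).Nonempty

open Classical in
/-- The edges between the north-going flow lines from `i₁` and `i₂`, visited from time `i₂` on. -/
noncomputable def MN (Z : ℤ → ℤ × ℤ) (i₁ i₂ : ℤ) : Set ℤ :=
  if i₁ = i₂ then ∅
  else if FN Z i₁ i₂ then
    bothEnds Z (northWestV Z i₁) ∩ someEnd Z (northEastV Z i₂) ∩ Set.Ici i₂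
  else
    someEnd Z (northEastV Z i₁) ∩ bothEnds Z (northWestV Z i₂) ∩ Set.Ici i₂

open Classical in
/-- The edges between the south-going flow lines from `i₁` and `i₂`, visited up to time `i₁`. -/
noncomputable def MS (Z : ℤ → ℤ × ℤ) (i₁ i₂ : ℤ) : Set ℤ :=
  if i₁ = i₂ then ∅
  else if FS Z i₁ i₂ then
    bothEnds Z (southWestV Z i₂) ∩ someEnd Z (southEastV Z i₁) ∩ Set.Iic i₁
  else
    someEnd Z (southEastV Z i₂) ∩ bothEnds Z (southWestV Z i₁) ∩ Set.Iic i₁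

/-- For a random set `M m ω` of edges: each `M m` is almost surely finite, `m⁻¹ * #(M m)` is a
random variable, and the laws of these variables, `m = 1, 2, …`, are tight. -/
def TightRescaledCard {Ω : Type*} [MeasurableSpace Ω] (P : Measure Ω)
    (M : ℕ → Ω → Set ℤ) : Prop :=
  (∀ m : ℕ, 1 ≤ m → ∀ᵐ ω ∂P, (M m ω).Finite) ∧
  (∀ m : ℕ, 1 ≤ m → AEMeasurable (fun ω => (m : ℝ)⁻¹ * ((M m ω).ncard : ℝ)) P) ∧
  IsTightMeasureSet
    {ν : Measure ℝ | ∃ m : ℕ, 1 ≤ m ∧ ν = P.map (fun ω => (m : ℝ)⁻¹ * ((M m ω).ncard : ℝ))}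

end BipolarMap

/-! Record a north-going flow line by its position on the boundary of the explored map: `0` at the
active edge, positive above it, negative below it. A step of the walk changes the position by
`move`: nonnegative positions follow the first coordinate of the walk, negative ones follow minus
the second. Both increments are uniform on {1, 0, -1}, so the position is a lazy simple random walk,
and two lines that once have equal positions stay together.

Topology. Positions are extended to all times (`IsDualPath`). Declaring the bottom of `e` west when
`p e < 0` and its top west when `p e ≤ 0` respects every gluing (`IsDualPath.endWest_glue`). Hence a
dual path splits the vertices of the whole map into two sides, with no appeal to planarity, and an
edge can change sides only where `p e = 0`. After two lines have merged, no later edge lies between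
them, so `MN` sits between time `i₂` and the merging time (`MN_subset`), whichever of the two cases
defines it. South-going lines are treated through the half-turn `rev`.

Probability. During `k = O(m)` steps the first line moves `O(√m)` away from the active edge, where
the second line then starts. On the same side of `0` the two lines move in parallel; the gap
fluctuates, as a lazy walk, only while `0` separates them. A Lyapunov function shows that they merge
within time of order `m`: `pairFun` is a supermartingale before merging as long as it is below `S`,
and the parabola `timeFun` limits the time spent in that window. Their combination `mergeBound`
loses `1 / N` per step on average, so by `IsEncodingWalk.measure_chain_le` its initial value bounds
the probability of not merging within `N` steps. Taking `S` of order `√m` and `N` of order `m` gives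
`exists_merge_time`, hence finiteness and tightness. -/

namespace BipolarMap

/-! ### Dual paths and the sides of a dual path -/

/-- The position of a north-going flow line among the edges of the boundary at time `n` is `0` at
the active edge, positive on the upper stack and negative on the lower stack. It changes
by this rule when the walk makes the step `v`. -/
def move (v : ℤ × ℤ) (p : ℤ) : ℤ := if 0 ≤ p then p + v.1 else p - v.2

/-- The walk makes only the three admissible steps, and both of its coordinates take arbitrarily
low values in both directions of time. -/
structure IsGoodWalk (Z : ℤ → ℤ × ℤ) : Prop where
  step : ∀ n, Z (n + 1) - Z n ∈ ({(1, 0), (0, -1), (-1, 1)} : Finset (ℤ × ℤ))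
  fst_fwd : ∀ n c, ∃ k, n ≤ k ∧ (Z k).1 < c
  snd_fwd : ∀ n c, ∃ k, n ≤ k ∧ (Z k).2 < c
  fst_bwd : ∀ n c, ∃ k, k ≤ n ∧ (Z k).1 < c
  snd_bwd : ∀ n c, ∃ k, k ≤ n ∧ (Z k).2 < c

/-- The positions, at all times, of a dual path that leaves each face through its right side. The
path may leave the triangle of a step `(1,0)` through either edge of the right side. -/
def IsDualPath (Z : ℤ → ℤ × ℤ) (p : ℤ → ℤ) : Prop := ∀ n,
  ((Z (n + 1)).1 = (Z n).1 + 1 ∧ (Z (n + 1)).2 = (Z n).2 ∧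
    (p n < 0 ∧ p (n + 1) = p n ∨ 0 ≤ p n ∧ p (n + 1) = p n + 1 ∨ p n = 0 ∧ p (n + 1) = 0)) ∨
  ((Z (n + 1)).1 = (Z n).1 ∧ (Z (n + 1)).2 = (Z n).2 - 1 ∧
    (p n < 0 ∧ p (n + 1) = p n + 1 ∨ 0 ≤ p n ∧ p (n + 1) = p n)) ∨
  ((Z (n + 1)).1 = (Z n).1 - 1 ∧ (Z (n + 1)).2 = (Z n).2 + 1 ∧ p (n + 1) = p n - 1)

/-- The walk of the map rotated by half a turn. -/
def rev (Z : ℤ → ℤ × ℤ) (n : ℤ) : ℤ × ℤ := (Z (-n)).swap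

lemma rev_rev (Z : ℤ → ℤ × ℤ) : rev (rev Z) = Z := by
  funext n; simp [rev]

lemma IsGoodWalk.step_cases {Z : ℤ → ℤ × ℤ} (h : IsGoodWalk Z) (n : ℤ) :
    ((Z (n + 1)).1 = (Z n).1 + 1 ∧ (Z (n + 1)).2 = (Z n).2) ∨
    ((Z (n + 1)).1 = (Z n).1 ∧ (Z (n + 1)).2 = (Z n).2 - 1) ∨
    ((Z (n + 1)).1 = (Z n).1 - 1 ∧ (Z (n + 1)).2 = (Z n).2 + 1) := by
  have := h.step n
  simp only [Finset.mem_insert, Finset.mem_singleton, Prod.ext_iff, Prod.fst_sub,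
    Prod.snd_sub] at this
  omega

lemma IsGoodWalk.rev {Z : ℤ → ℤ × ℤ} (h : IsGoodWalk Z) : IsGoodWalk (rev Z) where
  step n := by
    have := h.step_cases (-n - 1)
    rw [sub_add_cancel] at this
    have e : -(n + 1) = -n - 1 := by ring
    simp only [BipolarMap.rev, e, Finset.mem_insert, Finset.mem_singleton, Prod.ext_iff,
      Prod.fst_sub, Prod.snd_sub, Prod.fst_swap, Prod.snd_swap]
    omega
  fst_fwd n c := by
    obtain ⟨k, hk, h'⟩ := h.snd_bwd (-n) c
    exact ⟨-k, by omega, by simpa [BipolarMap.rev]⟩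
  snd_fwd n c := by
    obtain ⟨k, hk, h'⟩ := h.fst_bwd (-n) c
    exact ⟨-k, by omega, by simpa [BipolarMap.rev]⟩
  fst_bwd n c := by
    obtain ⟨k, hk, h'⟩ := h.snd_fwd (-n) c
    exact ⟨-k, by omega, by simpa [BipolarMap.rev]⟩
  snd_bwd n c := by
    obtain ⟨k, hk, h'⟩ := h.fst_fwd (-n) c
    exact ⟨-k, by omega, by simpa [BipolarMap.rev]⟩

/-- This symmetry is why `IsDualPath` lets a path at position `0` stay at `0` in a step `(1,0)`: in
a step `(0,-1)` both `-1` and `0` lead to `0`, and the half-turn exchanges the two kinds of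
triangle. -/
lemma IsDualPath.rev {Z : ℤ → ℤ × ℤ} {p : ℤ → ℤ} (h : IsDualPath Z p) :
    IsDualPath (rev Z) (fun n => -p (-n)) := by
  intro n
  have := h (-n - 1)
  rw [sub_add_cancel] at this
  have e : -(n + 1) = -n - 1 := by ring
  simp only [BipolarMap.rev, e, Prod.fst_swap, Prod.snd_swap]
  omega

lemma IsFace.rev {Z : ℤ → ℤ × ℤ} {l r : List ℤ} (h : IsFace Z l r) :
    IsFace (rev Z) (r.map Neg.neg).reverse (l.map Neg.neg).reverse := by
  cases h with
  | push n k hstep hnk hk hmin =>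
    have := IsFace.pop (Z := BipolarMap.rev Z) (-(n + 1)) (-k) ?_ (by omega)
      (by simpa [BipolarMap.rev] using hk) ?_
    · simpa using this
    · simp only [Prod.ext_iff, Prod.fst_sub, Prod.snd_sub] at hstep
      simp only [BipolarMap.rev, Prod.ext_iff, Prod.fst_sub, Prod.snd_sub, Prod.fst_swap,
        Prod.snd_swap]
      have e : -(-(n + 1) + 1) = n := by ring
      rw [e, neg_neg]
      omega
    · intro i h1 h2
      simpa [BipolarMap.rev] using hmin (-i) (by omega) (by omega)
  | pop n j hstep hjn hj hmin =>
    have := IsFace.push (Z := BipolarMap.rev Z) (-(n + 1)) (-j) ?_ (by omega)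
      (by simpa [BipolarMap.rev] using hj) ?_
    · simpa using this
    · simp only [Prod.ext_iff, Prod.fst_sub, Prod.snd_sub] at hstep
      simp only [BipolarMap.rev, Prod.ext_iff, Prod.fst_sub, Prod.snd_sub, Prod.fst_swap,
        Prod.snd_swap]
      have e : -(-(n + 1) + 1) = n := by ring
      rw [e, neg_neg]
      omega
    · intro i h1 h2
      simpa [BipolarMap.rev] using hmin (-i) (by omega) (by omega)

/-- A dual path that leaves the face of a step `(1,0)` through the new missing edge
follows the first coordinate of the walk until this edge is visited. -/
lemma IsDualPath.eq_fst {Z : ℤ → ℤ × ℤ} {p : ℤ → ℤ} (h : IsDualPath Z p) {n k : ℤ}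
    (hL : (Z (n + 1)).1 = (Z n).1 + 1) (hmin : ∀ j, n < j → j < k → (Z n).1 < (Z j).1)
    (h0 : 0 ≤ p n) (h1 : p (n + 1) = p n + 1) :
    ∀ j, n < j → j ≤ k → p j = p n + (Z j).1 - (Z n).1 := by
  intro j hj
  induction j, (show n + 1 ≤ j from hj) using Int.leInduction with
  | base => intro _; omega
  | succ j hj' ih =>
    intro hjk
    have := ih (by omega) (by omega)
    have := hmin j (by omega) (by omega)
    have := h j
    omega

/-- At time `j` the missing edge pushed at step `n` has position `(Z j).1 - (Z n).1`. A path that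
starts below this edge stays below it until the edge becomes active at time `k`. -/
lemma IsDualPath.neg_of_push {Z : ℤ → ℤ × ℤ} {p : ℤ → ℤ} (h : IsDualPath Z p) {n k : ℤ}
    (hnk : n < k) (hL : (Z (n + 1)).1 = (Z n).1 + 1) (hk : (Z k).1 = (Z n).1)
    (hmin : ∀ j, n < j → j < k → (Z n).1 < (Z j).1) (h1 : p (n + 1) ≤ 0) : p k < 0 := by
  have key : ∀ j, n < j → j ≤ k → p j ≤ (Z j).1 - (Z n).1 - 1 := by
    intro j hj
    induction j, (show n + 1 ≤ j from hj) using Int.leInduction with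
    | base => intro _; omega
    | succ j hj' ih =>
      intro hjk
      have := ih (by omega) (by omega)
      have := hmin j (by omega) (by omega)
      have := h j
      omega
  have := key k hnk le_rfl
  omega

/-- How a dual path passes the three edges of the triangle of a step `(1,0)`. -/
lemma IsDualPath.push {Z : ℤ → ℤ × ℤ} {p : ℤ → ℤ} (h : IsDualPath Z p) {n k : ℤ}
    (hstep : Z (n + 1) - Z n = (1, 0)) (hnk : n < k) (hk : (Z k).1 = (Z n).1)
    (hmin : ∀ j, n < j → j < k → (Z n).1 < (Z j).1) :
    (p n < 0 ↔ p (n + 1) < 0) ∧ (p (n + 1) ≤ 0 ↔ p k < 0) ∧ (p n ≤ 0 ↔ p k ≤ 0) := by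
  simp only [Prod.ext_iff, Prod.fst_sub, Prod.snd_sub] at hstep
  have hn := h n
  by_cases h1 : p (n + 1) ≤ 0
  · have := h.neg_of_push hnk (by omega) hk hmin h1
    omega
  · have := h.eq_fst (by omega) hmin (by omega) (by omega) k hnk le_rfl
    omega

/-- How a dual path passes the three edges of the triangle of a step `(0,-1)`. -/
lemma IsDualPath.pop {Z : ℤ → ℤ × ℤ} {p : ℤ → ℤ} (h : IsDualPath Z p) {n j : ℤ}
    (hstep : Z (n + 1) - Z n = (0, -1)) (hjn : j < n + 1) (hj : (Z j).2 = (Z (n + 1)).2)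
    (hmin : ∀ i, j < i → i < n + 1 → (Z (n + 1)).2 < (Z i).2) :
    (p n ≤ 0 ↔ p (n + 1) ≤ 0) ∧ (p j ≤ 0 ↔ p n < 0) ∧ (p j < 0 ↔ p (n + 1) < 0) := by
  -- The half-turn makes this triangle the one of a step `(1,0)` at time `-(n + 1)`, and its lower
  -- left edge `j` becomes the missing edge.
  have := h.rev.push (n := -(n + 1)) (k := -j) ?_ (by omega)
    (by simpa [BipolarMap.rev] using hj) ?_
  · rw [neg_neg, show -(n + 1) + 1 = -n by ring] at this
    simp only [neg_neg] at this
    omega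
  · simp only [Prod.ext_iff, Prod.fst_sub, Prod.snd_sub] at hstep
    simp only [BipolarMap.rev, Prod.ext_iff, Prod.fst_sub, Prod.snd_sub, Prod.fst_swap,
      Prod.snd_swap]
    have e : -(-(n + 1) + 1) = n := by ring
    rw [e, neg_neg]
    omega
  · intro i h1 h2
    simpa [BipolarMap.rev] using hmin (-i) (by omega) (by omega)

/-- An edge end is on the west side of a dual path. -/
def endWest (p : ℤ → ℤ) : EdgeEnd → Prop
  | .bot e => p e < 0
  | .top e => p e ≤ 0

lemma pair_infix_singleton {α : Type*} {a b c : α} : ¬ [a, b] <:+: [c] := fun h => by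
  simpa using h.length_le

lemma pair_infix_pair {α : Type*} {a b c d : α} (h : [a, b] <:+: [c, d]) : a = c ∧ b = d := by
  simpa using h.eq_of_length rfl

/-- This replaces planarity. Gluing along a step `(-1,1)` is consistent because the position drops
by one; all gluings around a triangle reduce to `push` and `pop`. -/
lemma IsDualPath.endWest_glue {Z : ℤ → ℤ × ℤ} {p : ℤ → ℤ} (h : IsDualPath Z p) {x y : EdgeEnd}
    (hg : Glue Z x y) : endWest p x ↔ endWest p y := by
  cases hg with
  | edge n hstep =>
    simp only [Prod.ext_iff, Prod.fst_sub, Prod.snd_sub] at hstep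
    have := h n
    simp only [endWest]
    omega
  | left hf hab =>
    cases hf with
    | push n k hs hnk hk hmin => exact (pair_infix_singleton hab).elim
    | pop n j hs hjn hj hmin =>
      obtain ⟨rfl, rfl⟩ := pair_infix_pair hab
      exact (h.pop hs hjn hj hmin).2.1
  | right hf hab =>
    cases hf with
    | push n k hs hnk hk hmin =>
      obtain ⟨rfl, rfl⟩ := pair_infix_pair hab
      exact (h.push hs hnk hk hmin).2.1
    | pop n j hs hjn hj hmin => exact (pair_infix_singleton hab).elim
  | lowest hf ha hb =>
    cases hf with
    | push n k hs hnk hk hmin =>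
      obtain rfl : n = _ := by simpa using ha
      obtain rfl : n + 1 = _ := by simpa using hb
      exact (h.push hs hnk hk hmin).1
    | pop n j hs hjn hj hmin =>
      obtain rfl : j = _ := by simpa using ha
      obtain rfl : n + 1 = _ := by simpa using hb
      exact (h.pop hs hjn hj hmin).2.2
  | highest hf ha hb =>
    cases hf with
    | push n k hs hnk hk hmin =>
      obtain rfl : n = _ := by simpa using ha
      obtain rfl : k = _ := by simpa using hb
      exact (h.push hs hnk hk hmin).2.2
    | pop n j hs hjn hj hmin =>
      obtain rfl : n = _ := by simpa using ha
      obtain rfl : n + 1 = _ := by simpa using hb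
      exact (h.pop hs hjn hj hmin).1

/-- The vertex is on the west side of the dual path `p`. -/
def vertexWest {Z : ℤ → ℤ × ℤ} {p : ℤ → ℤ} (h : IsDualPath Z p) : Vertex Z → Prop :=
  Quot.lift (endWest p) fun _ _ hg => propext (h.endWest_glue hg)

lemma vertexWest_botV {Z : ℤ → ℤ × ℤ} {p : ℤ → ℤ} (h : IsDualPath Z p) (e : ℤ) :
    vertexWest h (botV Z e) ↔ p e < 0 := Iff.rfl

lemma vertexWest_topV {Z : ℤ → ℤ × ℤ} {p : ℤ → ℤ} (h : IsDualPath Z p) (e : ℤ) :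
    vertexWest h (topV Z e) ↔ p e ≤ 0 := Iff.rfl

/-- Edges that a dual path does not cross have both ends on the same side of it. -/
lemma vertexWest_iff_of_joined {Z : ℤ → ℤ × ℤ} {p : ℤ → ℤ} (h : IsDualPath Z p) {A : Set ℤ}
    (hA : ∀ e ∈ A, p e ≠ 0) {u v : Vertex Z} (huv : Joined Z A u v) :
    vertexWest h u ↔ vertexWest h v := by
  induction huv with
  | rel x y hxy =>
    obtain ⟨e, he, rfl, rfl⟩ := hxy
    have := hA e he
    rw [vertexWest_botV, vertexWest_topV]
    omega
  | refl x => rfl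
  | symm x y _ ih => exact ih.symm
  | trans x y z _ _ ih1 ih2 => exact ih1.trans ih2

/-! ### The dual path of a north-going flow line -/

/-- The positions of the north-going flow line from `i` at the times `i`, `i + 1`, … -/
def fwdPos (Z : ℤ → ℤ × ℤ) (i : ℤ) : ℕ → ℤ
  | 0 => 0
  | k + 1 => move (Z (i + k + 1) - Z (i + k)) (fwdPos Z i k)

/-- The positions at the times `i`, `i - 1`, … of a dual path that arrives at the edge `i`. -/
def bwdPos (Z : ℤ → ℤ × ℤ) (i : ℤ) : ℕ → ℤ
  | 0 => 0
  | k + 1 => max (bwdPos Z i k - ((Z (i - k)).1 - (Z (i - k - 1)).1)) 0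

/-- A dual path that arrives at the edge `i` and continues with the north-going flow line. -/
def northPath (Z : ℤ → ℤ × ℤ) (i n : ℤ) : ℤ :=
  if i ≤ n then fwdPos Z i (n - i).toNat else bwdPos Z i (i - n).toNat

lemma northPath_add (Z : ℤ → ℤ × ℤ) (i : ℤ) (k : ℕ) : northPath Z i (i + k) = fwdPos Z i k := by
  simp [northPath]

lemma northPath_self (Z : ℤ → ℤ × ℤ) (i : ℤ) : northPath Z i i = 0 := by
  simp [northPath, fwdPos]

lemma northPath_succ (Z : ℤ → ℤ × ℤ) {i n : ℤ} (h : i ≤ n) :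
    northPath Z i (n + 1) = move (Z (n + 1) - Z n) (northPath Z i n) := by
  obtain ⟨k, rfl⟩ := Int.le.dest h
  rw [northPath_add, add_assoc, show (k : ℤ) + 1 = ((k + 1 : ℕ) : ℤ) by simp, northPath_add]
  simp [fwdPos, add_assoc]

lemma northPath_sub (Z : ℤ → ℤ × ℤ) (i : ℤ) (k : ℕ) : northPath Z i (i - k) = bwdPos Z i k := by
  rcases Nat.eq_zero_or_pos k with rfl | hk
  · simp [northPath, bwdPos, fwdPos]
  · have : ¬ i ≤ i - k := by omega
    rw [northPath, if_neg this]
    congr 1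
    omega

lemma northPath_of_lt (Z : ℤ → ℤ × ℤ) {i n : ℤ} (h : n < i) :
    northPath Z i n = max (northPath Z i (n + 1) - ((Z (n + 1)).1 - (Z n).1)) 0 := by
  obtain ⟨k, rfl⟩ : ∃ k : ℕ, n = i - ((k + 1 : ℕ) : ℤ) := ⟨(i - n - 1).toNat, by omega⟩
  rw [northPath_sub, show i - ((k + 1 : ℕ) : ℤ) + 1 = i - k by push_cast; ring, northPath_sub,
    bwdPos, show i - ((k + 1 : ℕ) : ℤ) = i - k - 1 by push_cast; ring]

lemma northPath_nonneg (Z : ℤ → ℤ × ℤ) {i n : ℤ} (h : n ≤ i) : 0 ≤ northPath Z i n := by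
  rcases h.eq_or_lt with rfl | h
  · rw [northPath_self]
  · rw [northPath_of_lt Z h]
    exact le_max_right _ _

/-- After time `i` the rule is `move`. Before time `i` the truncation at `0` is active only in a
step `(1,0)` with `p (n + 1) = 0`, where the path passes from `n` to `n + 1` through the lower right
edge of the triangle. -/
lemma isDualPath_northPath {Z : ℤ → ℤ × ℤ} (hZ : IsGoodWalk Z) (i : ℤ) :
    IsDualPath Z (northPath Z i) := by
  intro n
  have hs := hZ.step_cases n
  rcases le_or_gt i n with h | h
  · have := northPath_succ Z h
    simp only [move, Prod.fst_sub, Prod.snd_sub] at this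
    split_ifs at this <;> omega
  · have := northPath_of_lt Z h
    have := northPath_nonneg Z (show n + 1 ≤ i from h)
    omega

/-- Two flow lines that have the same position at one time coincide from then on. -/
lemma northPath_eq_of_eq (Z : ℤ → ℤ × ℤ) {i j t n : ℤ} (hi : i ≤ t) (hj : j ≤ t)
    (h : northPath Z i t = northPath Z j t) (hn : t ≤ n) : northPath Z i n = northPath Z j n := by
  induction n, hn using Int.leInduction with
  | base => exact h
  | succ n hn ih => rw [northPath_succ Z (hi.trans hn), northPath_succ Z (hj.trans hn), ih]

/-! ### Existence of faces -/

/-- An integer sequence that goes down by at most `1` takes a given level on its way down. -/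
lemma exists_first_eq {f : ℤ → ℤ} (hf : ∀ n, f n - 1 ≤ f (n + 1)) {n c : ℤ} (hn : c ≤ f n)
    (hlow : ∃ k, n ≤ k ∧ f k < c) :
    ∃ k, n ≤ k ∧ f k = c ∧ ∀ j, n ≤ j → j < k → c < f j := by
  obtain ⟨m, hm, hmc⟩ := hlow
  obtain ⟨d, rfl⟩ := Int.le.dest hm
  have hex : ∃ d : ℕ, f (n + d) ≤ c := ⟨d, hmc.le⟩
  classical
  have hspec := Nat.find_spec hex
  refine ⟨n + Nat.find hex, by omega, ?_, ?_⟩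
  · rcases Nat.eq_zero_or_pos (Nat.find hex) with h0 | h0
    · rw [h0] at hspec ⊢
      simp only [Nat.cast_zero, add_zero] at hspec ⊢
      omega
    · have h1 := Nat.find_min hex (m := Nat.find hex - 1) (by omega)
      have h2 := hf (n + (Nat.find hex - 1 : ℕ))
      rw [show n + ((Nat.find hex - 1 : ℕ) : ℤ) + 1 = n + Nat.find hex by omega] at h2
      omega
  · intro j hj hjk
    obtain ⟨a, rfl⟩ := Int.le.dest hj
    have := Nat.find_min hex (m := a) (by omega)
    omega

lemma IsGoodWalk.exists_push {Z : ℤ → ℤ × ℤ} (hZ : IsGoodWalk Z) {n : ℤ}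
    (hs : Z (n + 1) - Z n = (1, 0)) : ∃ k, IsFace Z [n] [n + 1, k] := by
  have hs' := hs
  simp only [Prod.ext_iff, Prod.fst_sub, Prod.snd_sub] at hs
  obtain ⟨k, hk, hkL, hmin⟩ := exists_first_eq (f := fun n => (Z n).1) (c := (Z n).1) (n := n + 1)
    (fun n => by have := hZ.step_cases n; omega) (by omega) (hZ.fst_fwd _ _)
  exact ⟨k, .push n k hs' (by omega) hkL fun j h1 h2 => hmin j (by omega) h2⟩

lemma IsGoodWalk.exists_pop {Z : ℤ → ℤ × ℤ} (hZ : IsGoodWalk Z) {n : ℤ}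
    (hs : Z (n + 1) - Z n = (0, -1)) : ∃ j, IsFace Z [j, n] [n + 1] := by
  have hs' : BipolarMap.rev Z (-(n + 1) + 1) - BipolarMap.rev Z (-(n + 1)) = (1, 0) := by
    simp only [Prod.ext_iff, Prod.fst_sub, Prod.snd_sub] at hs
    simp only [BipolarMap.rev, Prod.ext_iff, Prod.fst_sub, Prod.snd_sub, Prod.fst_swap,
      Prod.snd_swap]
    rw [show -(-(n + 1) + 1) = n by ring, neg_neg]
    omega
  obtain ⟨k, hk⟩ := hZ.rev.exists_push hs'
  have := hk.rev
  rw [rev_rev] at this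
  exact ⟨-k, by simpa using this⟩

/-- The edge visited after a step `(-1,1)` belongs to the triangle of an earlier step. -/
lemma IsGoodWalk.exists_push_of_up {Z : ℤ → ℤ × ℤ} (hZ : IsGoodWalk Z) {e : ℤ}
    (hs : Z (e + 1) - Z e = (-1, 1)) : ∃ n, IsFace Z [n] [n + 1, e + 1] := by
  simp only [Prod.ext_iff, Prod.fst_sub, Prod.snd_sub] at hs
  obtain ⟨k, hk, hkL, hmin⟩ := exists_first_eq (f := fun n => (Z (-n)).1)
    (c := (Z (e + 1)).1) (n := -e)
    (fun n => by
      have := hZ.step_cases (-n - 1)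
      rw [sub_add_cancel] at this
      simp only [neg_add, ← sub_eq_add_neg]
      omega) (by simp; omega)
    (by
      obtain ⟨k, h1, h2⟩ := hZ.fst_bwd e (Z (e + 1)).1
      exact ⟨-k, by omega, by simp; omega⟩)
  have hmin' : ∀ j, -k < j → j < e + 1 → (Z (-k)).1 < (Z j).1 := by
    intro j h1 h2
    have := hmin (-j) (by omega) (by omega)
    simp only [neg_neg] at this
    omega
  have hke : -k ≠ e := by
    intro h
    rw [h] at hkL
    omega
  refine ⟨-k, .push (-k) (e + 1) ?_ (by omega) (by omega) hmin'⟩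
  have h1 := hmin' (-k + 1) (by omega) (by omega)
  have h2 := hZ.step_cases (-k)
  simp only [Prod.ext_iff, Prod.fst_sub, Prod.snd_sub]
  omega

/-! ### Sides of north-going flow lines -/

/-- The north-going flow line from `i` consists of the edges crossed by `northPath Z i`. -/
lemma mem_northLine {Z : ℤ → ℤ × ℤ} (hZ : IsGoodWalk Z) {i e : ℤ} (hi : i ≤ e)
    (he : northPath Z i e = 0) : e ∈ northLine Z i := by
  obtain ⟨d, hd⟩ : ∃ d : ℕ, d = (e - i).toNat := ⟨_, rfl⟩
  induction d using Nat.strong_induction_on generalizing e with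
  | _ d ih =>
  rcases hi.eq_or_lt with rfl | hlt
  · exact Relation.ReflTransGen.refl
  obtain ⟨n, rfl⟩ : ∃ n, e = n + 1 := ⟨e - 1, by ring⟩
  have hp := isDualPath_northPath hZ i
  have key : ∀ a, a < n + 1 → i ≤ a → northPath Z i a = 0 → NStep Z a (n + 1) →
      n + 1 ∈ northLine Z i := fun a h1 h2 h3 h4 =>
    Relation.ReflTransGen.tail (ih (a - i).toNat (by omega) h2 h3 rfl) h4
  have hpn := hp n
  have hmv := northPath_succ Z (show i ≤ n by omega)
  have hst := hZ.step n
  simp only [Finset.mem_insert, Finset.mem_singleton] at hst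
  rcases hst with hs | hs | hs
  · rw [hs, he] at hmv
    simp only [move] at hmv
    split_ifs at hmv <;> omega
  · obtain ⟨j, hf⟩ := hZ.exists_pop hs
    have hf' := hf
    cases hf' with
    | pop _ _ _ hjn hj hmin =>
    have hcol := hp.pop hs hjn hj hmin
    simp only [Prod.ext_iff, Prod.fst_sub, Prod.snd_sub] at hs
    by_cases h0 : northPath Z i n = 0
    · exact key n (by omega) (by omega) h0 ⟨_, _, hf, by simp, by simp⟩
    · have hj0 : northPath Z i j = 0 := by omega
      refine key j hjn ?_ hj0 ⟨_, _, hf, by simp, by simp⟩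
      -- The second coordinate exceeds its value at `j` right after `j`, so step `j` is `(-1,1)` and
      -- moves the path from `0` to `-1`. This is impossible up to time `i`, when positions are
      -- nonnegative.
      by_contra hji
      have h1 := northPath_nonneg Z (show j + 1 ≤ i by omega)
      have h2 := hp j
      have h3 : j ≠ n := by
        rintro rfl
        omega
      have h4 := hmin (j + 1) (by omega) (by omega)
      omega
  · obtain ⟨k, hf⟩ := hZ.exists_push_of_up hs
    have hf' := hf
    cases hf' with
    | push _ _ hs' hnk hk hmin =>
    have hcol := hp.push hs' hnk hk hmin
    simp only [Prod.ext_iff, Prod.fst_sub, Prod.snd_sub] at hs'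
    have hpk := hp k
    have hk0 : northPath Z i k = 0 := by omega
    refine key k hnk ?_ hk0 ⟨_, _, hf, by simp, by simp⟩
    -- Between `k` and `n + 1` the path follows a missing edge at positive position, whereas its
    -- position at time `i` is `0`.
    by_contra hki
    have h1 := hp.eq_fst (by omega) hmin (by omega) (by omega) i (by omega) (by omega)
    have h2 := hmin i (by omega) (by omega)
    rw [northPath_self] at h1
    omega

/-- The top of `i` is west of the path, and the west side propagates along the flow line. An edge
whose bottom is west has negative position, which happens only after time `i`. -/
lemma northPath_westLine {Z : ℤ → ℤ × ℤ} (hZ : IsGoodWalk Z) {i e : ℤ} (he : e ∈ westLine Z i) :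
    i ≤ e ∧ northPath Z i e ≤ 0 := by
  induction he with
  | refl => exact ⟨le_rfl, (northPath_self Z i).le⟩
  | @tail b c _ h ih =>
    have hp := isDualPath_northPath hZ i
    have h1 := (vertexWest_topV hp b).2 ih.2
    rw [h.1, vertexWest_botV] at h1
    refine ⟨?_, h1.le⟩
    by_contra hc
    have := northPath_nonneg Z (show c ≤ i by omega)
    omega

/-- After any other step, `e` is the highest left edge of the triangle sewn on at that step, hence
not the rightmost edge coming up to its top. -/
lemma eq_or_up_of_mem_eastLine {Z : ℤ → ℤ × ℤ} (hZ : IsGoodWalk Z) {i e : ℤ}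
    (he : e ∈ eastLine Z i) : e = i ∨ Z (e + 1) - Z e = (-1, 1) := by
  rcases Relation.ReflTransGen.cases_tail he with rfl | ⟨b, _, h⟩
  · exact .inl rfl
  · right
    have hst := hZ.step e
    simp only [Finset.mem_insert, Finset.mem_singleton] at hst
    rcases hst with hs | hs | hs
    · obtain ⟨k, hf⟩ := hZ.exists_push hs
      exact (h.2 ⟨_, _, hf, by simp⟩).elim
    · obtain ⟨k, hf⟩ := hZ.exists_pop hs
      exact (h.2 ⟨_, _, hf, by simp⟩).elim
    · exact hs

lemma northPath_ne_zero {Z : ℤ → ℤ × ℤ} (hZ : IsGoodWalk Z) {i e : ℤ}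
    (he : e ∈ future Z i \ northLine Z i) : northPath Z i e ≠ 0 := by
  rcases lt_or_ge e i with hlt | hle
  · rcases he.1 with h | h | h
    · exact absurd hlt (not_lt.2 h)
    · exact absurd hlt (not_lt.2 (northPath_westLine hZ h).1)
    · rcases eq_or_up_of_mem_eastLine hZ h with rfl | hs
      · exact absurd hlt (lt_irrefl _)
      · have h1 := northPath_nonneg Z (show e + 1 ≤ i by omega)
        have h2 := northPath_of_lt Z hlt
        simp only [Prod.ext_iff, Prod.fst_sub, Prod.snd_sub] at hs
        omega
  · exact fun h => he.2 (mem_northLine hZ hle h)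

/-- Only this inclusion, and the matching one for the east side, is needed: the region has to be
bounded, not identified. -/
lemma vertexWest_of_mem_northWestV {Z : ℤ → ℤ × ℤ} (hZ : IsGoodWalk Z) {i : ℤ} {v : Vertex Z}
    (hv : v ∈ northWestV Z i) : vertexWest (isDualPath_northPath hZ i) v :=
  (vertexWest_iff_of_joined _ (fun _ he => northPath_ne_zero hZ he) hv).1
    ((vertexWest_topV _ i).2 (northPath_self Z i).le)

lemma not_vertexWest_of_mem_northEastV {Z : ℤ → ℤ × ℤ} (hZ : IsGoodWalk Z) {i : ℤ} {v : Vertex Z}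
    (hv : v ∈ northEastV Z i) : ¬ vertexWest (isDualPath_northPath hZ i) v :=
  fun h => by
    have := (vertexWest_iff_of_joined _ (fun _ he => northPath_ne_zero hZ he) hv).2 h
    rw [vertexWest_botV, northPath_self] at this
    exact lt_irrefl _ this

lemma vertexWest_congr {Z : ℤ → ℤ × ℤ} {p q : ℤ → ℤ} (hp : IsDualPath Z p) (hq : IsDualPath Z q)
    {e : ℤ} (h : p e = q e) :
    (vertexWest hp (botV Z e) ↔ vertexWest hq (botV Z e)) ∧
    (vertexWest hp (topV Z e) ↔ vertexWest hq (topV Z e)) := by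
  simp only [vertexWest_botV, vertexWest_topV, h, and_self]

/-- An edge at which two dual paths have the same position is not between them. -/
lemma not_between {Z : ℤ → ℤ × ℤ} {p q : ℤ → ℤ} (hp : IsDualPath Z p) (hq : IsDualPath Z q)
    {W E : Set (Vertex Z)} (hW : ∀ v ∈ W, vertexWest hp v) (hE : ∀ v ∈ E, ¬ vertexWest hq v)
    {e : ℤ} (h : p e = q e) : ¬ (e ∈ bothEnds Z W ∧ e ∈ someEnd Z E) := by
  rintro ⟨⟨hb, ht⟩, h' | h'⟩
  · exact hE _ h' ((vertexWest_congr hp hq h).1.1 (hW _ hb))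
  · exact hE _ h' ((vertexWest_congr hp hq h).2.1 (hW _ ht))

/-- The edges between two north-going flow lines are visited before the lines merge. -/
lemma MN_subset {Z : ℤ → ℤ × ℤ} (hZ : IsGoodWalk Z) {i₁ i₂ t : ℤ} (h12 : i₁ ≤ i₂) (ht : i₂ ≤ t)
    (h : northPath Z i₁ t = northPath Z i₂ t) : MN Z i₁ i₂ ⊆ Set.Ico i₂ t := by
  intro e he
  have hdp := isDualPath_northPath hZ
  have hW := fun i v hv => vertexWest_of_mem_northWestV (v := v) hZ (i := i) hv
  have hE := fun i v hv => not_vertexWest_of_mem_northEastV (v := v) hZ (i := i) hv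
  have key : t ≤ e → northPath Z i₁ e = northPath Z i₂ e :=
    northPath_eq_of_eq Z (h12.trans ht) ht h
  unfold MN at he
  split_ifs at he with h1 h2
  · exact he.elim
  · refine ⟨he.2, lt_of_not_ge fun hte => ?_⟩
    exact not_between (hdp i₁) (hdp i₂) (hW i₁) (hE i₂) (key hte) he.1
  · refine ⟨he.2, lt_of_not_ge fun hte => ?_⟩
    exact not_between (hdp i₂) (hdp i₁) (hW i₂) (hE i₁) (key hte).symm he.1.symm

/-! ### Sides of south-going flow lines -/

/-- The dual path of the south-going flow line from `i`. -/
def southPath (Z : ℤ → ℤ × ℤ) (i n : ℤ) : ℤ := -northPath (rev Z) (-i) (-n)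

lemma isDualPath_southPath {Z : ℤ → ℤ × ℤ} (hZ : IsGoodWalk Z) (i : ℤ) :
    IsDualPath Z (southPath Z i) := by
  have := (isDualPath_northPath hZ.rev (-i)).rev
  rwa [rev_rev] at this

lemma southPath_self (Z : ℤ → ℤ × ℤ) (i : ℤ) : southPath Z i i = 0 := by
  rw [southPath, northPath_self, neg_zero]

lemma southPath_nonpos (Z : ℤ → ℤ × ℤ) {i n : ℤ} (h : i ≤ n) : southPath Z i n ≤ 0 := by
  have := northPath_nonneg (rev Z) (show -n ≤ -i by omega)
  rw [southPath]
  omega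

lemma SStep_of_NStep_rev {Z : ℤ → ℤ × ℤ} {e e' : ℤ} (h : NStep (rev Z) e e') :
    SStep Z (-e) (-e') := by
  obtain ⟨l, r, hf, he, he'⟩ := h
  have := hf.rev
  rw [rev_rev] at this
  exact ⟨_, _, this, by simpa using he, by simp [he']⟩

lemma mem_southLine {Z : ℤ → ℤ × ℤ} (hZ : IsGoodWalk Z) {i e : ℤ} (hi : e ≤ i)
    (he : southPath Z i e = 0) : e ∈ southLine Z i := by
  have := mem_northLine hZ.rev (i := -i) (e := -e) (by omega) (neg_eq_zero.1 he)
  have := Relation.ReflTransGen.lift (p := SStep Z) Neg.neg (fun _ _ => SStep_of_NStep_rev) _ _ this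
  simpa [Function.onFun, southLine] using this

/-- Here the argument is run in the original map, with the roles of the two boundary lines
exchanged. Only faces and positions are transported by `rev`, so the vertex quotients of the two
maps need not be compared. -/
lemma southPath_eastLine {Z : ℤ → ℤ × ℤ} (hZ : IsGoodWalk Z) {i e : ℤ} (he : e ∈ eastLine Z i) :
    e ≤ i ∧ 0 ≤ southPath Z i e := by
  induction he with
  | refl => exact ⟨le_rfl, (southPath_self Z i).ge⟩
  | @tail b c _ h ih =>
    have hp := isDualPath_southPath hZ i
    have h1 : ¬ vertexWest hp (botV Z b) := by
      rw [vertexWest_botV]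
      omega
    rw [h.1, vertexWest_topV] at h1
    refine ⟨?_, by omega⟩
    by_contra hc
    have := southPath_nonpos Z (show i ≤ c by omega)
    omega

lemma eq_or_up_of_mem_westLine {Z : ℤ → ℤ × ℤ} (hZ : IsGoodWalk Z) {i e : ℤ}
    (he : e + 1 ∈ westLine Z i) : e + 1 = i ∨ Z (e + 1) - Z e = (-1, 1) := by
  rcases Relation.ReflTransGen.cases_tail he with h | ⟨b, _, h⟩
  · exact .inl h
  · right
    have hst := hZ.step e
    simp only [Finset.mem_insert, Finset.mem_singleton] at hst
    rcases hst with hs | hs | hs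
    · obtain ⟨k, hf⟩ := hZ.exists_push hs
      exact (h.2 ⟨_, _, hf, by simp⟩).elim
    · obtain ⟨k, hf⟩ := hZ.exists_pop hs
      exact (h.2 ⟨_, _, hf, by simp⟩).elim
    · exact hs

lemma southPath_ne_zero {Z : ℤ → ℤ × ℤ} (hZ : IsGoodWalk Z) {i e : ℤ}
    (he : e ∈ past Z i \ southLine Z i) : southPath Z i e ≠ 0 := by
  rcases lt_or_ge i e with hlt | hle
  · rcases he.1 with h | h | h
    · exact absurd hlt (not_lt.2 h)
    · obtain ⟨n, rfl⟩ : ∃ n, e = n + 1 := ⟨e - 1, by ring⟩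
      rcases eq_or_up_of_mem_westLine hZ h with rfl | hs
      · exact absurd hlt (lt_irrefl _)
      · have h1 := southPath_nonpos Z (show i ≤ n by omega)
        have h2 := isDualPath_southPath hZ i n
        simp only [Prod.ext_iff, Prod.fst_sub, Prod.snd_sub] at hs
        omega
    · exact absurd hlt (not_lt.2 (southPath_eastLine hZ h).1)
  · exact fun h => he.2 (mem_southLine hZ hle h)

lemma vertexWest_of_mem_southWestV {Z : ℤ → ℤ × ℤ} (hZ : IsGoodWalk Z) {i : ℤ} {v : Vertex Z}
    (hv : v ∈ southWestV Z i) : vertexWest (isDualPath_southPath hZ i) v :=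
  (vertexWest_iff_of_joined _ (fun _ he => southPath_ne_zero hZ he) hv).1
    ((vertexWest_topV _ i).2 (southPath_self Z i).le)

lemma not_vertexWest_of_mem_southEastV {Z : ℤ → ℤ × ℤ} (hZ : IsGoodWalk Z) {i : ℤ} {v : Vertex Z}
    (hv : v ∈ southEastV Z i) : ¬ vertexWest (isDualPath_southPath hZ i) v :=
  fun h => by
    have := (vertexWest_iff_of_joined _ (fun _ he => southPath_ne_zero hZ he) hv).2 h
    rw [vertexWest_botV, southPath_self] at this
    exact lt_irrefl _ this

/-- The edges between two south-going flow lines are visited after the lines merge. -/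
lemma MS_subset {Z : ℤ → ℤ × ℤ} (hZ : IsGoodWalk Z) {i₁ i₂ t : ℤ} (h12 : i₁ ≤ i₂) (ht : -i₁ ≤ t)
    (h : northPath (rev Z) (-i₂) t = northPath (rev Z) (-i₁) t) :
    MS Z i₁ i₂ ⊆ Set.Ioc (-t) i₁ := by
  intro e he
  have hdp := isDualPath_southPath hZ
  have hW := fun i v hv => vertexWest_of_mem_southWestV (v := v) hZ (i := i) hv
  have hE := fun i v hv => not_vertexWest_of_mem_southEastV (v := v) hZ (i := i) hv
  have key : e ≤ -t → southPath Z i₁ e = southPath Z i₂ e := fun het => by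
    rw [southPath, southPath,
      northPath_eq_of_eq (rev Z) (by omega) ht h (show t ≤ -e by omega)]
  unfold MS at he
  split_ifs at he with h1 h2
  · exact he.elim
  · refine ⟨lt_of_not_ge fun hte => ?_, he.2⟩
    exact not_between (hdp i₂) (hdp i₁) (hW i₂) (hE i₁) (key hte).symm he.1
  · refine ⟨lt_of_not_ge fun hte => ?_, he.2⟩
    exact not_between (hdp i₁) (hdp i₂) (hW i₁) (hE i₂) (key hte) he.1.symm

/-! ### Measurability -/

section Measurability

variable {X : Type*} [MeasurableSpace X]

/-- A random relation on a countable type has a measurable reflexive transitive closure. -/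
lemma measurable_reflTransGen {α : Type*} [Countable α] {R : X → α → α → Prop}
    (hR : ∀ a b, Measurable fun x => R x a b) (a b : α) :
    Measurable fun x => Relation.ReflTransGen (R x) a b := by
  let S : ℕ → X → α → Prop := fun n => Nat.rec (fun _ b => a = b)
    (fun _ ih x b => ∃ c, ih x c ∧ R x c b) n
  have hS : ∀ n b, Measurable fun x => S n x b := by
    intro n
    induction n with
    | zero => exact fun b => measurable_const
    | succ n ih => exact fun b => Measurable.exists fun c => (ih c).and (hR c b)
  have key : ∀ x b, Relation.ReflTransGen (R x) a b ↔ ∃ n, S n x b := by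
    intro x b
    constructor
    · intro h
      induction h with
      | refl => exact ⟨0, rfl⟩
      | tail _ h ih =>
        obtain ⟨n, hn⟩ := ih
        exact ⟨n + 1, _, hn, h⟩
    · rintro ⟨n, hn⟩
      induction n generalizing b with
      | zero =>
        obtain rfl : a = b := hn
        exact .refl
      | succ n ih =>
        obtain ⟨c, hc, hcb⟩ := hn
        exact (ih c hc).tail hcb
  simp only [key]
  exact Measurable.exists fun n => hS n b

lemma measurable_eqvGen {α : Type*} [Countable α] {R : X → α → α → Prop}
    (hR : ∀ a b, Measurable fun x => R x a b) (a b : α) :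
    Measurable fun x => Relation.EqvGen (R x) a b := by
  have key : ∀ x, Relation.EqvGen (R x) a b ↔
      Relation.ReflTransGen (fun c d => R x c d ∨ R x d c) a b := by
    intro x
    constructor
    · intro h
      induction h with
      | rel c d h => exact .single (.inl h)
      | refl c => exact .refl
      | symm c d _ ih =>
        have : Std.Symm fun c d => R x c d ∨ R x d c := ⟨fun _ _ h => h.symm⟩
        exact Relation.ReflTransGen.stdSymm.symm _ _ ih
      | trans c d e _ _ ih1 ih2 => exact ih1.trans ih2
    · intro h
      induction h with
      | refl => exact .refl _
      | tail _ h ih => exact ih.trans _ _ _ (h.elim (.rel _ _) fun h => .symm _ _ (.rel _ _ h))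
  simp only [key]
  exact measurable_reflTransGen (fun c d => (hR c d).or (hR d c)) a b

/-- The number of elements of a random set of integers is a random variable. -/
lemma measurable_ncard {f : X → Set ℤ} (hf : ∀ e, Measurable fun x => e ∈ f x) :
    Measurable fun x => ((f x).ncard : ℝ) := by
  have key : ∀ x, ((f x).ncard : ℝ) =
      (∑' e : ℤ, {x | e ∈ f x}.indicator (fun _ => (1 : ENNReal)) x).toReal := by
    intro x
    have : ∑' e : ℤ, {x | e ∈ f x}.indicator (fun _ => (1 : ENNReal)) x
        = ((f x).encard : ENNReal) := by
      rw [← ENNReal.tsum_set_one, tsum_subtype (f x) (fun _ => (1 : ENNReal))]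
      rfl
    rw [this, Set.ncard]
    -- For an infinite set both sides are `0`, by the default values of `ncard` and `toReal`.
    cases h : (f x).encard with
    | top => simp
    | coe n => simp
  simp only [key]
  exact (Measurable.tsum fun e =>
    measurable_const.indicator (measurableSet_setOfPred.2 (hf e))).ennreal_toReal

end Measurability

/-! ### Measurability of the map and its regions as functions of the walk. -/

instance : Countable EdgeEnd := by
  refine Function.Injective.countable (f := fun x : EdgeEnd => match x with
    | .bot e => (e, false)
    | .top e => (e, true)) ?_
  rintro (a | a) (b | b) h <;> simp_all

abbrev Walk := ℤ → ℤ × ℤ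

lemma measurable_rel_walk (n m : ℤ) (r : ℤ × ℤ → ℤ × ℤ → Prop) :
    Measurable fun Z : Walk => r (Z n) (Z m) := by
  have h : Measurable fun Z : Walk => (Z n, Z m) :=
    (measurable_pi_apply n).prodMk (measurable_pi_apply m)
  exact (Measurable.of_discrete (f := fun a : (ℤ × ℤ) × (ℤ × ℤ) => r a.1 a.2)).comp h

lemma measurable_isFace (l r : List ℤ) : Measurable fun Z : Walk => IsFace Z l r := by
  have key : ∀ Z : Walk, IsFace Z l r ↔
      (∃ n k, (l = [n] ∧ r = [n + 1, k] ∧ n < k) ∧ Z (n + 1) - Z n = (1, 0) ∧ (Z k).1 = (Z n).1 ∧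
        ∀ j, (n < j ∧ j < k) → (Z n).1 < (Z j).1) ∨
      (∃ n j, (l = [j, n] ∧ r = [n + 1] ∧ j < n + 1) ∧ Z (n + 1) - Z n = (0, -1) ∧
        (Z j).2 = (Z (n + 1)).2 ∧
        ∀ i, (j < i ∧ i < n + 1) → (Z (n + 1)).2 < (Z i).2) := by
    intro Z
    constructor
    · rintro (⟨n, k, hs, hnk, hk, hmin⟩ | ⟨n, j, hs, hjn, hj, hmin⟩)
      · exact .inl ⟨n, k, ⟨rfl, rfl, hnk⟩, hs, hk, fun j h => hmin j h.1 h.2⟩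
      · exact .inr ⟨n, j, ⟨rfl, rfl, hjn⟩, hs, hj, fun i h => hmin i h.1 h.2⟩
    · rintro (⟨n, k, ⟨rfl, rfl, hnk⟩, hs, hk, hmin⟩ | ⟨n, j, ⟨rfl, rfl, hjn⟩, hs, hj, hmin⟩)
      · exact .push n k hs hnk hk fun j h1 h2 => hmin j ⟨h1, h2⟩
      · exact .pop n j hs hjn hj fun i h1 h2 => hmin i ⟨h1, h2⟩
  simp only [key]
  refine .or (.exists fun n => .exists fun k => .and measurable_const (.and ?_ (.and ?_
    (.forall fun j => .imp measurable_const ?_)))) (.exists fun n => .exists fun j =>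
    .and measurable_const (.and ?_ (.and ?_ (.forall fun i => .imp measurable_const ?_))))
  · exact measurable_rel_walk (n + 1) n fun a b => a - b = (1, 0)
  · exact measurable_rel_walk k n fun a b => a.1 = b.1
  · exact measurable_rel_walk n j fun a b => a.1 < b.1
  · exact measurable_rel_walk (n + 1) n fun a b => a - b = (0, -1)
  · exact measurable_rel_walk j (n + 1) fun a b => a.2 = b.2
  · exact measurable_rel_walk (n + 1) i fun a b => a.2 < b.2

lemma measurable_glue (x y : EdgeEnd) : Measurable fun Z : Walk => Glue Z x y := by
  have key : ∀ Z : Walk, Glue Z x y ↔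
      (∃ n, (x = .top n ∧ y = .bot (n + 1)) ∧ Z (n + 1) - Z n = (-1, 1)) ∨
      (∃ l r a b, IsFace Z l r ∧
        ((x = .top a ∧ y = .bot b ∧ [a, b] <:+: l) ∨ (x = .top a ∧ y = .bot b ∧ [a, b] <:+: r) ∨
        (x = .bot a ∧ y = .bot b ∧ l.head? = some a ∧ r.head? = some b) ∨
        (x = .top a ∧ y = .top b ∧ l.getLast? = some a ∧ r.getLast? = some b))) := by
    intro Z
    constructor
    · rintro (⟨n, hs⟩ | ⟨hf, h⟩ | ⟨hf, h⟩ | ⟨hf, ha, hb⟩ | ⟨hf, ha, hb⟩)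
      · exact .inl ⟨n, ⟨rfl, rfl⟩, hs⟩
      · exact .inr ⟨_, _, _, _, hf, .inl ⟨rfl, rfl, h⟩⟩
      · exact .inr ⟨_, _, _, _, hf, .inr (.inl ⟨rfl, rfl, h⟩)⟩
      · exact .inr ⟨_, _, _, _, hf, .inr (.inr (.inl ⟨rfl, rfl, ha, hb⟩))⟩
      · exact .inr ⟨_, _, _, _, hf, .inr (.inr (.inr ⟨rfl, rfl, ha, hb⟩))⟩
    · rintro (⟨n, ⟨rfl, rfl⟩, hs⟩ | ⟨l, r, a, b, hf, ⟨rfl, rfl, h⟩ | ⟨rfl, rfl, h⟩ |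
        ⟨rfl, rfl, ha, hb⟩ | ⟨rfl, rfl, ha, hb⟩⟩)
      · exact .edge n hs
      · exact .left hf h
      · exact .right hf h
      · exact .lowest hf ha hb
      · exact .highest hf ha hb
  simp only [key]
  exact .or (.exists fun n => .and measurable_const
    (measurable_rel_walk (n + 1) n fun a b => a - b = (-1, 1)))
    (.exists fun l => .exists fun r => .exists fun a => .exists fun b =>
      .and (measurable_isFace l r) measurable_const)

/-- The vertex that a given end of an edge belongs to. -/
def endV (Z : Walk) (x : EdgeEnd) : Vertex Z := Quot.mk _ x

lemma measurable_endV_eq (x y : EdgeEnd) : Measurable fun Z : Walk => endV Z x = endV Z y := by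
  have key : ∀ Z : Walk, endV Z x = endV Z y ↔ Relation.EqvGen (Glue Z) x y := fun Z => Quot.eq
  simp only [key]
  exact measurable_eqvGen measurable_glue x y

/-- The type of vertices depends on the walk. Pulling connectivity back to edge ends gives a random
relation on one fixed countable type. -/
lemma joined_endV_iff {Z : Walk} {A : Set ℤ} {x y : EdgeEnd} :
    Joined Z A (endV Z x) (endV Z y) ↔ Relation.EqvGen (fun a b => endV Z a = endV Z b ∨
      ∃ e, e ∈ A ∧ endV Z a = endV Z (.bot e) ∧ endV Z b = endV Z (.top e)) x y := by
  constructor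
  · intro h
    generalize hu : endV Z x = u at h
    generalize hv : endV Z y = v at h
    induction h generalizing x y with
    | rel u v huv =>
      obtain ⟨e, he, rfl, rfl⟩ := huv
      exact .rel _ _ (.inr ⟨e, he, hu, hv⟩)
    | refl u => exact .rel _ _ (.inl (hu.trans hv.symm))
    | symm u v _ ih => exact .symm _ _ (ih hv hu)
    | trans u v w _ _ ih1 ih2 =>
      obtain ⟨z, hz⟩ := Quot.exists_rep v
      exact .trans _ z _ (ih1 hu hz) (ih2 hz hv)
  · intro h
    induction h with
    | rel a b hab =>
      rcases hab with h | ⟨e, he, h1, h2⟩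
      · rw [h]
        exact .refl _
      · exact .rel _ _ ⟨e, he, h1, h2⟩
    | refl a => exact .refl _
    | symm a b _ ih => exact .symm _ _ ih
    | trans a b c _ _ ih1 ih2 => exact .trans _ _ _ ih1 ih2

lemma measurable_joined {A : Walk → Set ℤ} (hA : ∀ e, Measurable fun Z => e ∈ A Z)
    (x y : EdgeEnd) : Measurable fun Z : Walk => Joined Z (A Z) (endV Z x) (endV Z y) := by
  simp only [joined_endV_iff]
  exact measurable_eqvGen (fun a b => .or (measurable_endV_eq a b) (.exists fun e =>
    .and (hA e) (.and (measurable_endV_eq _ _) (measurable_endV_eq _ _)))) x y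

lemma measurable_exists_isFace (p : List ℤ → List ℤ → Prop) :
    Measurable fun Z : Walk => ∃ l r, IsFace Z l r ∧ p l r :=
  .exists fun l => .exists fun r => .and (measurable_isFace l r) measurable_const

lemma measurable_mem_westLine (i e : ℤ) : Measurable fun Z : Walk => e ∈ westLine Z i :=
  measurable_reflTransGen (fun a b => .and (measurable_endV_eq (.top a) (.bot b))
    (.not (measurable_exists_isFace fun _ r => r.head? = some b))) i e

lemma measurable_mem_eastLine (i e : ℤ) : Measurable fun Z : Walk => e ∈ eastLine Z i :=
  measurable_reflTransGen (fun a b => .and (measurable_endV_eq (.bot a) (.top b))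
    (.not (measurable_exists_isFace fun l _ => l.getLast? = some b))) i e

lemma measurable_mem_northLine (i e : ℤ) : Measurable fun Z : Walk => e ∈ northLine Z i :=
  measurable_reflTransGen (fun a b =>
    measurable_exists_isFace fun l r => a ∈ l ∧ r.getLast? = some b) i e

lemma measurable_mem_southLine (i e : ℤ) : Measurable fun Z : Walk => e ∈ southLine Z i :=
  measurable_reflTransGen (fun a b =>
    measurable_exists_isFace fun l r => a ∈ r ∧ l.head? = some b) i e

lemma measurable_mem_north (i e : ℤ) :
    Measurable fun Z : Walk => e ∈ future Z i \ northLine Z i :=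
  .and (.or measurable_const (.or (measurable_mem_westLine i e) (measurable_mem_eastLine i e)))
    (.not (measurable_mem_northLine i e))

lemma measurable_mem_south (i e : ℤ) :
    Measurable fun Z : Walk => e ∈ past Z i \ southLine Z i :=
  .and (.or measurable_const (.or (measurable_mem_westLine i e) (measurable_mem_eastLine i e)))
    (.not (measurable_mem_southLine i e))

lemma measurable_bothEnds {A : Walk → Set ℤ} (hA : ∀ e, Measurable fun Z => e ∈ A Z)
    (x : EdgeEnd) (e : ℤ) :
    Measurable fun Z : Walk => e ∈ bothEnds Z {v | Joined Z (A Z) (endV Z x) v} :=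
  .and (measurable_joined hA x (.bot e)) (measurable_joined hA x (.top e))

lemma measurable_someEnd {A : Walk → Set ℤ} (hA : ∀ e, Measurable fun Z => e ∈ A Z)
    (x : EdgeEnd) (e : ℤ) :
    Measurable fun Z : Walk => e ∈ someEnd Z {v | Joined Z (A Z) (endV Z x) v} :=
  .or (measurable_joined hA x (.bot e)) (measurable_joined hA x (.top e))

lemma measurable_mem_MN (i₁ i₂ e : ℤ) : Measurable fun Z : Walk => e ∈ MN Z i₁ i₂ := by
  by_cases h : i₁ = i₂
  · simp only [MN, if_pos h]
    exact measurable_const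
  have key : ∀ Z : Walk, e ∈ MN Z i₁ i₂ ↔
      (FN Z i₁ i₂ ∧ (e ∈ bothEnds Z (northWestV Z i₁) ∧ e ∈ someEnd Z (northEastV Z i₂)) ∧
        i₂ ≤ e) ∨
      (¬ FN Z i₁ i₂ ∧ (e ∈ someEnd Z (northEastV Z i₁) ∧ e ∈ bothEnds Z (northWestV Z i₂)) ∧
        i₂ ≤ e) := by
    intro Z
    unfold MN
    split_ifs with h' <;> simp [h']
  have hF : Measurable fun Z : Walk => FN Z i₁ i₂ :=
    .exists fun a => .and (measurable_mem_northLine i₁ a) (measurable_mem_eastLine i₂ a)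
  have hW := fun i => measurable_bothEnds (measurable_mem_north i) (.top i) e
  have hE := fun i => measurable_someEnd (measurable_mem_north i) (.bot i) e
  simp only [key]
  exact .or (.and hF (.and (.and (hW i₁) (hE i₂)) measurable_const))
    (.and (.not hF) (.and (.and (hE i₁) (hW i₂)) measurable_const))

lemma measurable_mem_MS (i₁ i₂ e : ℤ) : Measurable fun Z : Walk => e ∈ MS Z i₁ i₂ := by
  by_cases h : i₁ = i₂
  · simp only [MS, if_pos h]
    exact measurable_const
  have key : ∀ Z : Walk, e ∈ MS Z i₁ i₂ ↔
      (FS Z i₁ i₂ ∧ (e ∈ bothEnds Z (southWestV Z i₂) ∧ e ∈ someEnd Z (southEastV Z i₁)) ∧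
        e ≤ i₁) ∨
      (¬ FS Z i₁ i₂ ∧ (e ∈ someEnd Z (southEastV Z i₂) ∧ e ∈ bothEnds Z (southWestV Z i₁)) ∧
        e ≤ i₁) := by
    intro Z
    unfold MS
    split_ifs with h' <;> simp [h']
  have hF : Measurable fun Z : Walk => FS Z i₁ i₂ :=
    .exists fun a => .and (measurable_mem_southLine i₂ a) (measurable_mem_eastLine i₁ a)
  have hW := fun i => measurable_bothEnds (measurable_mem_south i) (.top i) e
  have hE := fun i => measurable_someEnd (measurable_mem_south i) (.bot i) e
  simp only [key]
  exact .or (.and hF (.and (.and (hW i₂) (hE i₁)) measurable_const))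
    (.and (.not hF) (.and (.and (hE i₂) (hW i₁)) measurable_const))

/-! ### Lyapunov functions -/

/-- The mean of a function over the three steps of the walk. -/
noncomputable def stepMean (f : ℤ × ℤ → ℝ) : ℝ := (f (1, 0) + f (0, -1) + f (-1, 1)) / 3

/-- A concave function that controls the distance of two flow lines. -/
noncomputable def gapFun (S s : ℝ) : ℝ := s + 24 * √(S * s)

/-- Squaring, the left side gives `2 S s + 2 S √(s² - 1)`, which is at most `4 S s - S / s`. Since
`s ≤ S` gives `√(S s) ≤ S`, this is at most the square of the right side. -/
lemma sqrt_second_difference {S s : ℝ} (hs : 2 ≤ s) (hS : s ≤ S) :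
    √(S * (s + 1)) + √(S * (s - 1)) ≤ 2 * √(S * s) - 1 / (4 * s) := by
  have hs0 : 0 < s := by linarith
  have hS0 : 0 < S := by linarith
  have hA := Real.sq_sqrt (show 0 ≤ S * (s + 1) by positivity)
  have hC := Real.sq_sqrt (show 0 ≤ S * (s - 1) from mul_nonneg hS0.le (by linarith))
  have hB := Real.sq_sqrt (show 0 ≤ S * s by positivity)
  have hA0 := Real.sqrt_nonneg (S * (s + 1))
  have hC0 := Real.sqrt_nonneg (S * (s - 1))
  have hB1 : √(S * s) ≤ S := Real.sqrt_le_iff.2 ⟨hS0.le, by nlinarith⟩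
  have hB2 : s ≤ √(S * s) := Real.le_sqrt_of_sq_le (by nlinarith)
  generalize √(S * (s + 1)) = A at *
  generalize √(S * (s - 1)) = C at *
  generalize √(S * s) = B at *
  have hinv : 1 / (4 * s) ≤ 1 := by
    rw [div_le_one (by positivity)]
    linarith
  have hinv' : 1 / (2 * s) ≤ 1 := by
    rw [div_le_one (by positivity)]
    linarith
  have hAC : A * C ≤ S * (s - 1 / (2 * s)) := by
    refine (le_abs_self _).trans (abs_le_of_sq_le_sq ?_ (mul_nonneg hS0.le (by linarith)))
    have : (S * (s - 1 / (2 * s))) ^ 2 = S ^ 2 * (s ^ 2 - 1) + (S * (1 / (2 * s))) ^ 2 := by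
      field_simp
      ring
    rw [this, mul_pow, hA, hC]
    nlinarith [sq_nonneg (S * (1 / (2 * s)))]
  refine (le_abs_self _).trans (abs_le_of_sq_le_sq ?_ (by linarith))
  have h1 : (2 * B - 1 / (4 * s)) ^ 2 = 4 * (S * s) - B / s + (1 / (4 * s)) ^ 2 := by
    rw [← hB]
    field_simp
    ring
  have h2 : S * (s - 1 / (2 * s)) = S * s - S / s / 2 := by
    field_simp
  have h3 : B / s ≤ S / s := by gcongr
  rw [h1]
  nlinarith [sq_nonneg (1 / (4 * s))]

/-- The factor `24` in `gapFun` is chosen to gain `6 / s`, the error of the product term in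
`pairFun_bulk`. -/
lemma gapFun_second_difference {S s : ℝ} (hs : 2 ≤ s) (hS : s ≤ S) :
    gapFun S (s + 1) + gapFun S (s - 1) ≤ 2 * gapFun S s - 6 / s := by
  have := sqrt_second_difference hs hS
  have h : 6 / s = 24 * (1 / (4 * s)) := by
    field_simp
    norm_num
  rw [h]
  unfold gapFun
  linarith

/-- The Lyapunov function of two flow lines with positions `p ≤ q`. -/
noncomputable def pairFun (S p q : ℝ) : ℝ :=
  max p 0 + max (-q - 1) 0 + gapFun S (q - p + 1) -
    2 * (max (q + 1) 0 * max (-p) 0) / (q - p + 1)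

lemma pairFun_of_nonneg {S p q : ℝ} (hp : 0 ≤ p) (hpq : p ≤ q) :
    pairFun S p q = p + gapFun S (q - p + 1) := by
  rw [pairFun, max_eq_left hp, max_eq_right (by linarith : -q - 1 ≤ 0),
    max_eq_right (by linarith : -p ≤ 0)]
  simp

lemma pairFun_of_le {S p q : ℝ} (hq : q ≤ -1) (hpq : p ≤ q) :
    pairFun S p q = -q - 1 + gapFun S (q - p + 1) := by
  rw [pairFun, max_eq_right (by linarith : p ≤ 0), max_eq_left (by linarith : 0 ≤ -q - 1),
    max_eq_right (by linarith : q + 1 ≤ 0)]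
  simp

/-- The range includes `p = 0` and `q = -1`, so it contains every pair reached in one step from `p ≤
-1`, `0 ≤ q`. -/
lemma pairFun_of_between {S p q : ℝ} (hp : p ≤ 0) (hq : -1 ≤ q) :
    pairFun S p q = gapFun S (q - p + 1) - 2 * ((q + 1) * (-p)) / (q - p + 1) := by
  rw [pairFun, max_eq_right hp, max_eq_right (by linarith : -q - 1 ≤ 0),
    max_eq_left (by linarith : 0 ≤ q + 1), max_eq_left (by linarith : 0 ≤ -p)]
  simp

lemma le_pairFun {S p q : ℝ} (hpq : p ≤ q) :
    max p 0 + max (-q - 1) 0 + (q - p + 1) / 2 + 24 * √(S * (q - p + 1)) ≤ pairFun S p q := by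
  have hs : 0 < q - p + 1 := by linarith
  -- If both factors are positive they add up to `q - p + 1`, and the bound is the inequality of
  -- arithmetic and geometric means.
  have h : 2 * (max (q + 1) 0 * max (-p) 0) / (q - p + 1) ≤ (q - p + 1) / 2 := by
    rw [div_le_iff₀ hs]
    rcases max_cases (q + 1) 0 with ⟨h1, _⟩ | ⟨h1, _⟩ <;>
    rcases max_cases (-p) 0 with ⟨h2, _⟩ | ⟨h2, _⟩ <;> rw [h1, h2] <;>
    nlinarith [sq_nonneg (q + 1 + p), sq_nonneg (q - p + 1)]
  unfold pairFun gapFun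
  linarith

lemma pairFun_nonneg {S p q : ℝ} (hpq : p ≤ q) : 0 ≤ pairFun S p q := by
  refine le_trans ?_ (le_pairFun hpq)
  have : 0 ≤ q - p + 1 := by linarith
  positivity

/-- If the gap exceeded `S`, the square root alone would exceed `S`. Then `p` is bounded above by
its positive part, and `-p` by the gap plus the positive part of `-q - 1`. -/
lemma bounds_of_pairFun_lt {S p q : ℝ} (hS : 0 ≤ S) (hpq : p ≤ q) (h : pairFun S p q < S) :
    q - p + 1 ≤ S ∧ |p| ≤ 2 * S := by
  have h1 := le_pairFun (S := S) hpq
  have h2 := le_max_right p 0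
  have h3 := le_max_right (-q - 1) 0
  have h4 := le_max_left p 0
  have h5 := le_max_left (-q - 1) 0
  have h6 := Real.sqrt_nonneg (S * (q - p + 1))
  have h7 : q - p + 1 ≤ S := by
    by_contra hc
    have : S ≤ √(S * (q - p + 1)) := Real.le_sqrt_of_sq_le (by nlinarith)
    linarith
  exact ⟨h7, abs_le.2 ⟨by linarith, by linarith⟩⟩

/-- With `u = q + 1`, `v = -p`, `s = u + v`, the term `-2 u v / s` raises the sum over the three
steps by at most `6 / s`, because `(s - 2) (s + 1) ≥ 0`. The concavity of `gapFun` pays for it. -/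
lemma pairFun_bulk {S p q : ℝ} (hp : p ≤ -1) (hq : 0 ≤ q) (hS : q - p + 1 ≤ S) :
    pairFun S p (q + 1) + pairFun S (p + 1) q + pairFun S (p - 1) (q - 1) ≤
      3 * pairFun S p q := by
  rw [pairFun_of_between (by linarith) (by linarith), pairFun_of_between (by linarith) (by linarith),
    pairFun_of_between (by linarith) (by linarith), pairFun_of_between (by linarith) (by linarith)]
  obtain ⟨u, rfl⟩ : ∃ u, q = u - 1 := ⟨q + 1, by ring⟩
  obtain ⟨v, rfl⟩ : ∃ v, p = -v := ⟨-p, by ring⟩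
  have hg := gapFun_second_difference (S := S) (s := u - 1 - -v + 1) (by linarith) hS
  rw [show u - 1 + 1 - -v + 1 = u - 1 - -v + 1 + 1 by ring,
    show u - 1 - (-v + 1) + 1 = u - 1 - -v + 1 - 1 by ring,
    show u - 1 - 1 - (-v - 1) + 1 = u - 1 - -v + 1 by ring]
  obtain ⟨s, hs⟩ : ∃ s, u - 1 - -v + 1 = s := ⟨_, rfl⟩
  rw [hs] at hg hS ⊢
  have hs2 : 2 ≤ s := by linarith
  have huv : 0 ≤ u * v := mul_nonneg (by linarith) (by linarith)
  have key : 3 * (2 * ((u - 1 + 1) * - -v) / s) - 2 * ((u - 1 + 1 + 1) * - -v) / (s + 1) -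
      2 * ((u - 1 + 1) * -(-v + 1)) / (s - 1) - 2 * ((u - 1 - 1 + 1) * -(-v - 1)) / s ≤ 6 / s := by
    have h0 : 0 < s := by linarith
    have h1 : 0 < s - 1 := by linarith
    have h2 : 0 < s + 1 := by linarith
    have hu : u = s - v := by linarith
    have e : 6 / s - (3 * (2 * ((u - 1 + 1) * - -v) / s) - 2 * ((u - 1 + 1 + 1) * - -v) / (s + 1) -
      2 * ((u - 1 + 1) * -(-v + 1)) / (s - 1) - 2 * ((u - 1 - 1 + 1) * -(-v - 1)) / s) =
      (4 * (u * v) + 4 * (s ^ 2 - 1) - 2 * v * (s - 1) - 2 * u * (s + 1)) /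
        (s * (s - 1) * (s + 1)) := by
      rw [hu]
      field_simp
      ring
    have : 0 ≤ (4 * (u * v) + 4 * (s ^ 2 - 1) - 2 * v * (s - 1) - 2 * u * (s + 1)) /
        (s * (s - 1) * (s + 1)) := by
      apply div_nonneg _ (by positivity)
      rw [hu] at huv ⊢
      nlinarith [mul_nonneg (sub_nonneg.2 hs2) h2.le]
    linarith
  linarith

lemma one_le_two_mul_div {x : ℝ} (hx : 2 ≤ x) : 1 ≤ 2 * (x - 1) / x := by
  rw [le_div_iff₀ (by linarith)]
  linarith

/-- The cut-off parabola that bounds the time which a position spends in `[-2 * S, 2 * S]`. -/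
noncomputable def timeFun (S p : ℝ) : ℝ := max (16 * S ^ 2 - p ^ 2) 0

lemma timeFun_nonneg (S p : ℝ) : 0 ≤ timeFun S p := le_max_right _ _

lemma timeFun_le (S p : ℝ) : timeFun S p ≤ 16 * S ^ 2 :=
  max_le (by nlinarith [sq_nonneg p]) (by positivity)

lemma timeFun_mean {S p : ℝ} (hS : 1 ≤ S) (hp : |p| ≤ 2 * S) :
    (timeFun S (p + 1) + timeFun S p + timeFun S (p - 1)) / 3 = timeFun S p - 2 / 3 := by
  have h := abs_le.1 hp
  -- One step away from the window the cut-off is still inactive: `(2 S + 1)² ≤ 9 S² ≤ 16 S²`.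
  have key : ∀ x, |x| ≤ 2 * S + 1 → timeFun S x = 16 * S ^ 2 - x ^ 2 := by
    intro x hx
    have h := abs_le.1 hx
    exact max_eq_left (by nlinarith)
  rw [key _ (abs_le.2 ⟨by linarith, by linarith⟩), key _ (abs_le.2 ⟨by linarith, by linarith⟩),
    key _ (abs_le.2 ⟨by linarith, by linarith⟩)]
  ring

lemma stepMean_move (f : ℤ → ℝ) (p : ℤ) :
    stepMean (fun v => f (move v p)) = (f (p + 1) + f p + f (p - 1)) / 3 := by
  simp only [stepMean, move]
  split_ifs
  · simp only [add_zero, ← sub_eq_add_neg]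
  · simp only [sub_zero, sub_neg_eq_add]
    ring

/-- With both lines on one side of `0` the gap is constant and the position of the inner line is a
martingale. Its positive part gains only when that line crosses (from `p = 0` or `q = -1`). There
the product term supplies `2 (s - 1) / s ≥ 1`, which is enough. Lines separated by `0` are the case
of `pairFun_bulk`. -/
lemma stepMean_pairFun_le {S : ℝ} {p q : ℤ} (hpq : p < q) (hS : (q : ℝ) - p + 1 ≤ S) :
    stepMean (fun v => pairFun S (move v p : ℤ) (move v q : ℤ)) ≤ pairFun S p q := by
  have hpq' : (p : ℝ) + 1 ≤ q := by exact_mod_cast hpq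
  simp only [stepMean]
  rcases le_or_gt 0 p with hp | hp
  · have hq : 0 ≤ q := by omega
    have hpr : (0 : ℝ) ≤ p := by exact_mod_cast hp
    simp only [move, if_pos hp, if_pos hq]
    push_cast
    rw [add_zero, add_zero, pairFun_of_nonneg (p := (p : ℝ)) hpr (by linarith),
      pairFun_of_nonneg (p := (p : ℝ) + 1) (by linarith) (by linarith), add_sub_add_right_eq_sub]
    rcases hp.eq_or_lt with rfl | hp0
    · rw [pairFun_of_between (by simp) (by linarith), add_sub_add_right_eq_sub]
      have := one_le_two_mul_div (x := (q : ℝ) - (0 : ℤ) + 1) (by linarith)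
      push_cast at this ⊢
      simp only [sub_zero, zero_add, neg_neg, mul_one, neg_add_cancel_right,
        add_sub_cancel_right] at this ⊢
      linarith
    · have hp1 : (1 : ℝ) ≤ p := by exact_mod_cast hp0
      rw [pairFun_of_nonneg (by linarith) (by linarith), add_sub_add_right_eq_sub]
      linarith
  · have hpr : (p : ℝ) ≤ -1 := by exact_mod_cast (show p ≤ -1 by omega)
    rcases le_or_gt 0 q with hq | hq
    · have hqr : (0 : ℝ) ≤ q := by exact_mod_cast hq
      simp only [move, if_neg (not_le.2 hp), if_pos hq]
      push_cast
      rw [sub_zero, sub_neg_eq_add, add_zero, ← sub_eq_add_neg]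
      have := pairFun_bulk hpr hqr hS
      linarith
    · have hqr : (q : ℝ) ≤ -1 := by exact_mod_cast (show q ≤ -1 by omega)
      simp only [move, if_neg (not_le.2 hp), if_neg (not_le.2 hq)]
      push_cast
      rw [sub_zero, sub_zero, sub_neg_eq_add, sub_neg_eq_add,
        pairFun_of_le (q := (q : ℝ)) hqr (by linarith),
        pairFun_of_le (q := (q : ℝ) - 1) (by linarith) (by linarith), sub_sub_sub_cancel_right]
      rcases (show q ≤ -1 by omega).eq_or_lt with rfl | hq1
      · rw [pairFun_of_between (by linarith) (by simp), add_sub_add_right_eq_sub]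
        have := one_le_two_mul_div (x := ((-1 : ℤ) : ℝ) - p + 1) (by linarith)
        push_cast at this ⊢
        have e : (2 * ((-1 + 1 + 1) * -((p : ℝ) + 1)) / (-1 - p + 1)) =
          2 * (-1 - (p : ℝ) + 1 - 1) / (-1 - p + 1) := by
          congr 1
          ring
        rw [e]
        linarith
      · have hq2 : (q : ℝ) ≤ -2 := by exact_mod_cast (show q ≤ -2 by omega)
        rw [pairFun_of_le (by linarith) (by linarith), add_sub_add_right_eq_sub]
        linarith

lemma stepMean_add (f g : ℤ × ℤ → ℝ) :
    stepMean (fun v => f v + g v) = stepMean f + stepMean g := by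
  unfold stepMean
  ring

lemma stepMean_mul_const (f : ℤ × ℤ → ℝ) (c : ℝ) :
    stepMean (fun v => f v * c) = stepMean f * c := by
  unfold stepMean
  ring

/-- The probability that two flow lines with positions `p ≤ q` do not merge during the next `N` steps
is at most this number. -/
noncomputable def mergeBound (S N : ℝ) (x : ℤ × ℤ) : ℝ :=
  pairFun S x.1 x.2 * S⁻¹ + timeFun S x.1 * (3 / 2 * N⁻¹)

/-- A value below `1` forces `pairFun < S`, hence a gap at most `S` and `|p| ≤ 2 S`, where both
drift estimates hold. The mean loss `2 / 3` of `timeFun` times `3 / 2 * N⁻¹` is `1 / N`. -/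
lemma stepMean_mergeBound_le {S N : ℝ} (hS : 1 ≤ S) (hN : 0 < N) {x : ℤ × ℤ} (hx : x.1 < x.2)
    (h1 : mergeBound S N x < 1) :
    stepMean (fun v => mergeBound S N (move v x.1, move v x.2)) ≤ mergeBound S N x - N⁻¹ := by
  have hS0 : 0 < S := by linarith
  have hxr : (x.1 : ℝ) ≤ x.2 := by exact_mod_cast hx.le
  have hV : pairFun S x.1 x.2 < S := by
    have := mul_nonneg (timeFun_nonneg S x.1) (show 0 ≤ 3 / 2 * N⁻¹ by positivity)
    unfold mergeBound at h1
    have h : pairFun S x.1 x.2 * S⁻¹ < 1 := by linarith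
    rwa [← div_eq_mul_inv, div_lt_one hS0] at h
  obtain ⟨hs, hp⟩ := bounds_of_pairFun_lt hS0.le hxr hV
  have hpair := stepMean_pairFun_le hx hs
  have htime := stepMean_move (fun p => timeFun S p) x.1
  push_cast at htime
  rw [timeFun_mean hS hp] at htime
  simp only [mergeBound]
  rw [stepMean_add, stepMean_mul_const, stepMean_mul_const, htime]
  have := mul_le_mul_of_nonneg_right hpair (inv_nonneg.2 hS0.le)
  linarith

lemma mergeBound_nonneg {S N : ℝ} (hS : 0 ≤ S) (hN : 0 ≤ N) {x : ℤ × ℤ} (hx : x.1 ≤ x.2) :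
    0 ≤ mergeBound S N x := by
  have h1 := pairFun_nonneg (S := S) (show (x.1 : ℝ) ≤ x.2 by exact_mod_cast hx)
  have h2 := timeFun_nonneg S x.1
  unfold mergeBound
  positivity

/-- The bound for a flow line that starts at the active edge and a line at distance at most `K`. -/
lemma mergeBound_le {S N K : ℝ} (hS : 0 < S) (hN : 0 < N) {a : ℤ} (ha : |(a : ℝ)| ≤ K) :
    mergeBound S N (min a 0, max a 0) ≤ gapFun S (K + 1) / S + 24 * S ^ 2 / N := by
  have h1 : pairFun S (min a 0 : ℤ) (max a 0 : ℤ) ≤ gapFun S (K + 1) := by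
    have hmono : gapFun S (|(a : ℝ)| + 1) ≤ gapFun S (K + 1) := by
      unfold gapFun
      gcongr
    refine le_trans ?_ hmono
    rcases le_total 0 a with h | h
    · have hr : (0 : ℝ) ≤ a := by exact_mod_cast h
      rw [min_eq_right h, max_eq_left h, pairFun_of_nonneg (by simp) (by simpa), abs_of_nonneg hr]
      simp
    · have hr : (a : ℝ) ≤ 0 := by exact_mod_cast h
      rw [min_eq_left h, max_eq_right h, pairFun_of_between hr (by simp), abs_of_nonpos hr]
      have : 0 ≤ 2 * ((((0 : ℤ) : ℝ) + 1) * -(a : ℝ)) / (((0 : ℤ) : ℝ) - a + 1) := by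
        push_cast
        apply div_nonneg <;> linarith
      push_cast at this ⊢
      rw [zero_sub] at this ⊢
      linarith
  have h2 := timeFun_le S ((min a 0 : ℤ) : ℝ)
  unfold mergeBound
  have e : 24 * S ^ 2 / N = 16 * S ^ 2 * (3 / 2 * N⁻¹) := by
    rw [div_eq_mul_inv]
    ring
  rw [e, div_eq_mul_inv _ S]
  gcongr

lemma move_le_move {v : ℤ × ℤ} (hv : v ∈ ({(1, 0), (0, -1), (-1, 1)} : Finset (ℤ × ℤ))) {p q : ℤ}
    (hpq : p ≤ q) : move v p ≤ move v q := by
  simp only [Finset.mem_insert, Finset.mem_singleton, Prod.ext_iff] at hv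
  simp only [move]
  split_ifs <;> omega

/-! ### The lowest value of a coordinate -/

/-- Adds the increment `c v` to a height until it is no longer positive. -/
def absorb (c : ℤ × ℤ → ℤ) (v : ℤ × ℤ) (a : ℤ) : ℤ := if 0 < a then a + c v else a

noncomputable def absorbBound (S N : ℝ) (a : ℤ) : ℝ :=
  max (a : ℝ) 0 * S⁻¹ + timeFun S a * (3 / 2 * N⁻¹)

/-- The hypothesis `hc` says that the increment is uniform on {1, 0, -1}. Until absorption the
height is then a martingale, and the whole loss comes from `timeFun`. -/
lemma stepMean_absorbBound_le {c : ℤ × ℤ → ℤ}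
    (hc : ∀ f : ℤ → ℝ, f (c (1, 0)) + f (c (0, -1)) + f (c (-1, 1)) = f 1 + f 0 + f (-1))
    {S N : ℝ} (hS : 1 ≤ S) (hN : 0 < N) {a : ℤ} (ha : 0 < a) (h1 : absorbBound S N a < 1) :
    stepMean (fun v => absorbBound S N (absorb c v a)) ≤ absorbBound S N a - N⁻¹ := by
  have hS0 : 0 < S := by linarith
  have har : (1 : ℝ) ≤ a := by exact_mod_cast ha
  have haS : (a : ℝ) < S := by
    have := mul_nonneg (timeFun_nonneg S a) (show 0 ≤ 3 / 2 * N⁻¹ by positivity)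
    unfold absorbBound at h1
    have h : max (a : ℝ) 0 * S⁻¹ < 1 := by linarith
    rw [← div_eq_mul_inv, div_lt_one hS0] at h
    exact (le_max_left _ _).trans_lt h
  have htime := timeFun_mean (p := (a : ℝ)) hS (by rw [abs_of_pos (by linarith)]; linarith)
  have hmean : ∀ f : ℤ → ℝ, stepMean (fun v => f (absorb c v a)) =
      (f (a + 1) + f a + f (a - 1)) / 3 := by
    intro f
    have := hc fun x => f (a + x)
    simp only [stepMean, absorb, if_pos ha]
    rw [this, add_zero, ← sub_eq_add_neg]
  rw [hmean]
  simp only [absorbBound]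
  push_cast
  rw [max_eq_left (by linarith), max_eq_left (by linarith), max_eq_left (by linarith)]
  have e : (timeFun S (a + 1) + timeFun S a + timeFun S (a - 1)) =
    3 * (timeFun S a - 2 / 3) := by linarith
  have : (((a : ℝ) + 1) * S⁻¹ + timeFun S (a + 1) * (3 / 2 * N⁻¹) +
      ((a : ℝ) * S⁻¹ + timeFun S a * (3 / 2 * N⁻¹)) +
      (((a : ℝ) - 1) * S⁻¹ + timeFun S (a - 1) * (3 / 2 * N⁻¹))) / 3 =
      a * S⁻¹ + (timeFun S (a + 1) + timeFun S a + timeFun S (a - 1)) / 3 * (3 / 2 * N⁻¹) := by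
    ring
  rw [this, e]
  linarith

lemma absorbBound_nonneg {S N : ℝ} (hS : 0 ≤ S) (hN : 0 ≤ N) (a : ℤ) :
    0 ≤ absorbBound S N a := by
  have h2 := timeFun_nonneg S a
  unfold absorbBound
  positivity

lemma absorbBound_le {S N : ℝ} (hN : 0 < N) {a : ℤ} (ha : 0 ≤ a) :
    absorbBound S N a ≤ a / S + 24 * S ^ 2 / N := by
  have h2 := timeFun_le S a
  unfold absorbBound
  have e : 24 * S ^ 2 / N = 16 * S ^ 2 * (3 / 2 * N⁻¹) := by
    rw [div_eq_mul_inv]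
    ring
  rw [e, div_eq_mul_inv _ S, max_eq_left (by exact_mod_cast ha)]
  gcongr

/-! ### The walk as a source of independent steps -/

section Probability

variable {Ω : Type*}

/-- The events that are determined by the steps of the walk before time `n`. -/
@[reducible] def stepsBefore (Z : ℤ → Ω → ℤ × ℤ) (n : ℤ) : MeasurableSpace Ω :=
  ⨆ j ∈ Set.Iio n, MeasurableSpace.comap (fun ω => Z (j + 1) ω - Z j ω) inferInstance

lemma stepsBefore_mono {Z : ℤ → Ω → ℤ × ℤ} {m n : ℤ} (h : m ≤ n) : stepsBefore Z m ≤ stepsBefore Z n :=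
  biSup_mono fun _ hj => lt_of_lt_of_le hj h

lemma measurable_step_stepsBefore (Z : ℤ → Ω → ℤ × ℤ) (n : ℤ) :
    Measurable[stepsBefore Z (n + 1)] fun ω => Z (n + 1) ω - Z n ω :=
  Measurable.of_comap_le (le_iSup₂_of_le (f := fun (j : ℤ) (_ : j ∈ Set.Iio (n + 1)) =>
    MeasurableSpace.comap (fun ω => Z (j + 1) ω - Z j ω) inferInstance) n (lt_add_one n) le_rfl)

lemma measurable_chain {Z : ℤ → Ω → ℤ × ℤ} {S : Type*} [Countable S] [MeasurableSpace S]
    [DiscreteMeasurableSpace S] {a : ℤ} {X : ℕ → Ω → S} {F : ℤ × ℤ → S → S}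
    (h0 : Measurable[stepsBefore Z a] (X 0))
    (hX : ∀ n ω, X (n + 1) ω = F (Z (a + n + 1) ω - Z (a + n) ω) (X n ω)) (n : ℕ) {b : ℤ}
    (hb : a + n = b) : Measurable[stepsBefore Z b] (X n) := by
  induction n generalizing b with
  | zero =>
    obtain rfl : a = b := by simpa using hb
    exact h0
  | succ n ih =>
    obtain rfl : a + n + 1 = b := by rw [← hb]; push_cast; ring
    have e : X (n + 1) = fun ω => F (Z (a + n + 1) ω - Z (a + n) ω) (X n ω) := funext (hX n)
    rw [e]
    have h1 : Measurable[stepsBefore Z (a + n + 1)] fun ω =>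
        (Z (a + n + 1) ω - Z (a + n) ω, X n ω) :=
      Measurable.prodMk (measurable_step_stepsBefore Z (a + n))
        ((ih rfl).mono (stepsBefore_mono (by omega)) le_rfl)
    exact (Measurable.of_discrete (f := fun y : (ℤ × ℤ) × S => F y.1 y.2)).comp h1

lemma stepMean_mono {f g : ℤ × ℤ → ℝ}
    (h : ∀ v ∈ ({(1, 0), (0, -1), (-1, 1)} : Finset (ℤ × ℤ)), f v ≤ g v) :
    stepMean f ≤ stepMean g := by
  have h1 := h (1, 0) (by decide)
  have h2 := h (0, -1) (by decide)
  have h3 := h (-1, 1) (by decide)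
  unfold stepMean
  linarith

lemma stepMean_const (c : ℝ) : stepMean (fun _ => c) = c := by
  unfold stepMean
  ring

variable [MeasurableSpace Ω] {P : Measure Ω} {Z : ℤ → Ω → ℤ × ℤ}

lemma IsEncodingWalk.measurable_step (hZ : IsEncodingWalk P Z) (n : ℤ) :
    Measurable fun ω => Z (n + 1) ω - Z n ω :=
  (hZ.measurable (n + 1)).sub (hZ.measurable n)

lemma IsEncodingWalk.stepsBefore_le (hZ : IsEncodingWalk P Z) (n : ℤ) :
    stepsBefore Z n ≤ ‹MeasurableSpace Ω› :=
  iSup₂_le fun j _ => (hZ.measurable_step j).comap_le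

lemma IsEncodingWalk.indep_stepsBefore (hZ : IsEncodingWalk P Z) (n : ℤ) :
    Indep (stepsBefore Z n)
      (MeasurableSpace.comap (fun ω => Z (n + 1) ω - Z n ω) inferInstance) P := by
  have := indep_iSup_of_disjoint (fun j => (hZ.measurable_step j).comap_le) hZ.indep.iIndep
    (S := Set.Iio n) (T := {n}) (by simp)
  simp only [Set.mem_singleton_iff, iSup_iSup_eq_left] at this
  exact this

variable [IsProbabilityMeasure P]

lemma IsEncodingWalk.ae_step (hZ : IsEncodingWalk P Z) (n : ℤ) :
    ∀ᵐ ω ∂P, Z (n + 1) ω - Z n ω ∈ ({(1, 0), (0, -1), (-1, 1)} : Finset (ℤ × ℤ)) := by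
  have hm : ∀ v : ℤ × ℤ, MeasurableSet {ω | Z (n + 1) ω - Z n ω = v} := fun v =>
    hZ.measurable_step n (measurableSet_singleton v)
  have hset : {ω | Z (n + 1) ω - Z n ω ∈ ({(1, 0), (0, -1), (-1, 1)} : Finset (ℤ × ℤ))} =
      ⋃ v ∈ ({(1, 0), (0, -1), (-1, 1)} : Finset (ℤ × ℤ)), {ω | Z (n + 1) ω - Z n ω = v} := by
    ext ω
    simp
  have h1 : P {ω | Z (n + 1) ω - Z n ω ∈ ({(1, 0), (0, -1), (-1, 1)} : Finset (ℤ × ℤ))} = 1 := by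
    rw [hset, measure_biUnion_finset]
    · rw [Finset.sum_congr rfl (hZ.uniform n)]
      simp only [Finset.sum_const]
      rw [show ({(1, 0), (0, -1), (-1, 1)} : Finset (ℤ × ℤ)).card = 3 by decide]
      simp [ENNReal.mul_inv_cancel]
    · intro v _ w _ hvw
      exact Set.disjoint_left.2 fun ω h1 h2 => hvw (h1.symm.trans h2)
    · exact fun v _ => hm v
  refine (mem_ae_iff_prob_eq_one₀ ?_).2 h1
  rw [hset]
  exact (Finset.measurableSet_biUnion _ fun v _ => hm v).nullMeasurableSet

/-- The mean over the next step, given the earlier steps. -/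
lemma IsEncodingWalk.lintegral_step (hZ : IsEncodingWalk P Z) {S : Type*} [Countable S]
    [MeasurableSpace S] [DiscreteMeasurableSpace S] {n : ℤ} {Y : Ω → S}
    (hY : Measurable[stepsBefore Z n] Y) {f : S → ℤ × ℤ → ℝ} (hf : ∀ x v, 0 ≤ f x v) :
    ∫⁻ ω, ENNReal.ofReal (f (Y ω) (Z (n + 1) ω - Z n ω)) ∂P =
      ∫⁻ ω, ENNReal.ofReal (stepMean (f (Y ω))) ∂P := by
  set ξ : Ω → ℤ × ℤ := fun ω => Z (n + 1) ω - Z n ω with hξ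
  have hmean : ∀ x, ENNReal.ofReal (stepMean (f x)) =
      ∑ v ∈ ({(1, 0), (0, -1), (-1, 1)} : Finset (ℤ × ℤ)), ENNReal.ofReal (f x v) * (1 / 3) := by
    intro x
    have h3 : (1 / 3 : ENNReal) = ENNReal.ofReal (1 / 3) := by
      rw [ENNReal.ofReal_div_of_pos (by norm_num)]
      simp
    rw [h3]
    simp only [← ENNReal.ofReal_mul (hf x _)]
    rw [← ENNReal.ofReal_sum_of_nonneg fun v _ => mul_nonneg (hf x v) (by norm_num)]
    congr 1
    rw [Finset.sum_insert (by decide), Finset.sum_insert (by decide), Finset.sum_singleton,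
      stepMean]
    ring
  have hsplit : ∀ᵐ ω ∂P, ENNReal.ofReal (f (Y ω) (ξ ω)) =
      ∑ v ∈ ({(1, 0), (0, -1), (-1, 1)} : Finset (ℤ × ℤ)),
        ENNReal.ofReal (f (Y ω) v) * (ξ ⁻¹' {v}).indicator 1 ω := by
    filter_upwards [hZ.ae_step n] with ω hω
    rw [Finset.sum_eq_single_of_mem _ hω]
    · simp [hξ]
    · intro v _ hv
      have : ω ∉ ξ ⁻¹' {v} := fun h => hv (Eq.symm h)
      rw [Set.indicator_of_notMem this, mul_zero]
  have hfm : ∀ v, Measurable[stepsBefore Z n] fun ω => ENNReal.ofReal (f (Y ω) v) := fun v =>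
    (Measurable.of_discrete (f := fun x => ENNReal.ofReal (f x v))).comp hY
  have hgm : ∀ v, Measurable[MeasurableSpace.comap ξ inferInstance]
      ((ξ ⁻¹' {v}).indicator (1 : Ω → ENNReal)) := fun v =>
    (@measurable_one _ _ _ (_) (_)).indicator ⟨{v}, measurableSet_singleton v, rfl⟩
  have hterm : ∀ v ∈ ({(1, 0), (0, -1), (-1, 1)} : Finset (ℤ × ℤ)),
      ∫⁻ ω, ENNReal.ofReal (f (Y ω) v) * (ξ ⁻¹' {v}).indicator 1 ω ∂P =
      ∫⁻ ω, ENNReal.ofReal (f (Y ω) v) * (1 / 3) ∂P := by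
    intro v hv
    rw [lintegral_mul_eq_lintegral_mul_lintegral_of_independent_measurableSpace
      (hZ.stepsBefore_le n) (hZ.measurable_step n).comap_le (hZ.indep_stepsBefore n) (hfm v)
      (hgm v), lintegral_indicator_one (hZ.measurable_step n (measurableSet_singleton v)),
      show P (ξ ⁻¹' {v}) = 1 / 3 from hZ.uniform n v hv, lintegral_mul_const]
    exact (hfm v).mono (hZ.stepsBefore_le n) le_rfl
  rw [lintegral_congr_ae hsplit]
  simp only [hmean]
  rw [lintegral_finsetSum, lintegral_finsetSum]
  · exact Finset.sum_congr rfl hterm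
  · exact fun v _ => ((hfm v).mono (hZ.stepsBefore_le n) le_rfl).mul_const _
  · exact fun v _ => ((hfm v).mono (hZ.stepsBefore_le n) le_rfl).mul
      ((hgm v).mono (hZ.measurable_step n).comap_le le_rfl)

/-- A Lyapunov function bounds the probability that a chain is still in `B` at time `N`. -/
lemma IsEncodingWalk.measure_chain_le (hZ : IsEncodingWalk P Z) {S : Type*} [Countable S]
    [MeasurableSpace S] [DiscreteMeasurableSpace S] {a : ℤ} {X : ℕ → Ω → S}
    {F : ℤ × ℤ → S → S} (h0 : Measurable[stepsBefore Z a] (X 0))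
    (hX : ∀ n ω, X (n + 1) ω = F (Z (a + n + 1) ω - Z (a + n) ω) (X n ω))
    {B : Set S} (hB : ∀ v ∈ ({(1, 0), (0, -1), (-1, 1)} : Finset (ℤ × ℤ)), ∀ x ∉ B, F v x ∉ B)
    {N : ℕ} (hN : 0 < N) {G : S → ℝ}
    (hG1 : ∀ x ∈ B, 0 ≤ G x) (hG0 : ∀ x ∈ B, ∀ v ∈ ({(1, 0), (0, -1), (-1, 1)} : Finset (ℤ × ℤ)), 0 ≤ G (F v x))
    (hG : ∀ x ∈ B, G x < 1 → stepMean (fun v => G (F v x)) ≤ G x - (N : ℝ)⁻¹) :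
    P {ω | X N ω ∈ B} ≤ ∫⁻ ω, ENNReal.ofReal (min 1 (G (X 0 ω))) ∂P := by
  classical
  have hNr : (0 : ℝ) < N := by exact_mod_cast hN
  -- `H r x` bounds the probability of still being in `B` after `r` more steps from `x`. It is `1`
  -- on `B` for `r = 0` and `min 1 (G x)` on `B` for `r = N`.
  let H : ℕ → S → ℝ := fun r x => if x ∈ B then max 0 (min 1 (G x + 1 - r / N)) else 0
  have hH0 : ∀ r x, 0 ≤ H r x := by
    intro r x
    simp only [H]
    split_ifs
    · exact le_max_left _ _
    · exact le_rfl
  have hH1 : ∀ r x, H r x ≤ 1 := by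
    intro r x
    simp only [H]
    split_ifs
    · exact max_le zero_le_one (min_le_left _ _)
    · exact zero_le_one
  have hstep : ∀ r x, r + 1 ≤ N → stepMean (fun v => H r (F v x)) ≤ H (r + 1) x := by
    intro r x hr
    have hr' : ((r + 1 : ℕ) : ℝ) / N ≤ 1 := by
      rw [div_le_one hNr]
      exact_mod_cast hr
    by_cases hx : x ∈ B
    -- If `G x ≥ (r + 1) / N` the bound is the trivial `1`; otherwise `G x < 1` and the drift
    -- hypothesis applies.
    · by_cases h1 : ((r + 1 : ℕ) : ℝ) / N ≤ G x
      · have : H (r + 1) x = 1 := by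
          simp only [H, if_pos hx]
          rw [min_eq_left (by linarith), max_eq_right zero_le_one]
        rw [this]
        exact (stepMean_mono fun v _ => hH1 r (F v x)).trans_eq (stepMean_const 1)
      · push Not at h1
        have hle : stepMean (fun v => H r (F v x)) ≤
            stepMean (fun v => G (F v x) + (1 - r / N)) := by
          refine stepMean_mono fun v hv => ?_
          have hpos : 0 ≤ G (F v x) + (1 - r / N) := by
            have h2 := hG0 x hx v hv
            have h3 : (r : ℝ) / N ≤ ((r + 1 : ℕ) : ℝ) / N := by
              gcongr
              simp
            linarith
          simp only [H]
          split_ifs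
          · exact max_le hpos ((min_le_right _ _).trans_eq (by ring))
          · exact hpos
        refine hle.trans ?_
        rw [stepMean_add, stepMean_const]
        have h2 := hG x hx (h1.trans_le hr')
        have h3 : ((r + 1 : ℕ) : ℝ) / N = r / N + (N : ℝ)⁻¹ := by
          push_cast
          rw [add_div, one_div]
        simp only [H, if_pos hx]
        refine le_trans ?_ (le_max_right _ _)
        rw [min_eq_right (by linarith)]
        linarith
    · refine (stepMean_mono fun v hv => ?_).trans_eq (stepMean_const (H (r + 1) x))
      simp only [H, if_neg hx, if_neg (hB v hv x hx), le_refl]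
  have hXm := measurable_chain h0 hX
  have hmono : ∀ n ≤ N, ∫⁻ ω, ENNReal.ofReal (H (N - n) (X n ω)) ∂P ≤
      ∫⁻ ω, ENNReal.ofReal (H N (X 0 ω)) ∂P := by
    intro n hn
    induction n with
    | zero => exact le_rfl
    | succ n ih =>
      refine le_trans ?_ (ih (by omega))
      simp only [hX n]
      rw [hZ.lintegral_step (hXm n rfl) (f := fun x v => H (N - (n + 1)) (F v x))
        (fun x v => hH0 _ _)]
      refine lintegral_mono fun ω => ENNReal.ofReal_le_ofReal ?_
      have := hstep (N - (n + 1)) (X n ω) (by omega)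
      rwa [show N - (n + 1) + 1 = N - n by omega] at this
  have hXN : Measurable (X N) := (hXm N rfl).mono (hZ.stepsBefore_le _) le_rfl
  have hlast : P {ω | X N ω ∈ B} ≤ ∫⁻ ω, ENNReal.ofReal (H (N - N) (X N ω)) ∂P := by
    rw [← lintegral_indicator_one (s := {ω | X N ω ∈ B}) (hXN (MeasurableSet.of_discrete (s := B)))]
    refine lintegral_mono fun ω => ?_
    by_cases h : X N ω ∈ B
    · rw [Set.indicator_of_mem (show ω ∈ {ω | X N ω ∈ B} from h)]
      have : H (N - N) (X N ω) = 1 := by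
        simp only [H, if_pos h, Nat.sub_self, Nat.cast_zero, zero_div, sub_zero]
        rw [min_eq_left (by linarith [hG1 _ h]), max_eq_right zero_le_one]
      rw [this]
      simp
    · rw [Set.indicator_of_notMem (show ω ∉ {ω | X N ω ∈ B} from h)]
      exact zero_le
  refine (hlast.trans (hmono N le_rfl)).trans (lintegral_mono fun ω => ?_)
  by_cases h : X 0 ω ∈ B
  · refine ENNReal.ofReal_le_ofReal ?_
    simp only [H, if_pos h, div_self hNr.ne', add_sub_cancel_right]
    exact max_le (le_min zero_le_one (hG1 _ h)) le_rfl
  · simp [H, h]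

end Probability

section Walk

variable {Ω : Type*}

lemma measurable_northPath (Z : ℤ → Ω → ℤ × ℤ) (i : ℤ) (k : ℕ) {b : ℤ} (hb : i + k = b) :
    Measurable[stepsBefore Z b] fun ω => northPath (fun n => Z n ω) i b := by
  have := measurable_chain (Z := Z) (X := fun k ω => northPath (fun n => Z n ω) i (i + k)) (a := i)
    (F := move) (by
      simp only [Nat.cast_zero, add_zero, northPath_self]
      exact measurable_const)
    (fun n ω => by
      push_cast
      rw [← add_assoc]
      exact northPath_succ (fun n => Z n ω) (by omega)) k hb
  rwa [hb] at this

variable [MeasurableSpace Ω] {P : Measure Ω} {Z : ℤ → Ω → ℤ × ℤ}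

/-! ### Criterion for tightness -/

/-- One estimate serves twice: for fixed `m`, letting `ε` tend to `0` gives almost sure finiteness;
for fixed `ε`, the compact set `[0, B]` works for all `m`. -/
lemma tightRescaledCard_of_bound {M : ℕ → Ω → Set ℤ}
    (hmeas : ∀ m, Measurable fun ω => ((M m ω).ncard : ℝ))
    (hbound : ∀ ε : ℝ, 0 < ε → ∃ B : ℕ, ∀ m, 1 ≤ m →
      P {ω | ¬ ((M m ω).Finite ∧ (M m ω).ncard ≤ B * m)} ≤ ENNReal.ofReal ε) :
    TightRescaledCard P M := by
  refine ⟨fun m hm => ?_, fun m _ => ((hmeas m).const_mul _).aemeasurable, ?_⟩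
  · rw [ae_iff]
    refine le_antisymm (ENNReal.le_of_forall_pos_le_add fun ε hε _ => ?_) zero_le
    obtain ⟨B, hB⟩ := hbound ε hε
    rw [zero_add]
    refine (measure_mono fun ω hω => ?_).trans ((hB m hm).trans_eq (by simp))
    exact fun h => hω h.1
  · rw [isTightMeasureSet_iff_exists_isCompact_measure_compl_le]
    intro ε hε
    obtain ⟨δ, hδ0, hδ⟩ : ∃ δ : ℝ, 0 < δ ∧ ENNReal.ofReal δ ≤ ε := by
      obtain ⟨δ, hδ0, hδ⟩ := ENNReal.lt_iff_exists_nnreal_btwn.1 hε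
      exact ⟨δ, by simpa using hδ0, by simpa using hδ.le⟩
    obtain ⟨B, hB⟩ := hbound δ hδ0
    refine ⟨Set.Icc 0 B, isCompact_Icc, ?_⟩
    rintro _ ⟨m, hm, rfl⟩
    rw [Measure.map_apply ((hmeas m).const_mul _) measurableSet_Icc.compl]
    refine (measure_mono fun ω hω => ?_).trans ((hB m hm).trans hδ)
    rintro ⟨-, h⟩
    refine hω ⟨by positivity, ?_⟩
    have hm0 : (0 : ℝ) < m := by exact_mod_cast hm
    have h' : ((M m ω).ncard : ℝ) ≤ B * m := by exact_mod_cast h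
    rw [inv_mul_le_iff₀ hm0]
    linarith

/-! ### Almost all walks are good -/

lemma IsEncodingWalk.measurable_walk (hZ : IsEncodingWalk P Z) :
    Measurable fun ω => (fun n => Z n ω : Walk) :=
  measurable_pi_lambda _ hZ.measurable

lemma IsEncodingWalk.rev (hZ : IsEncodingWalk P Z) :
    IsEncodingWalk P (fun n ω => rev (fun k => Z k ω) n) where
  measurable n := measurable_swap.comp (hZ.measurable (-n))
  start ω := by simp [BipolarMap.rev, hZ.start ω]
  indep := by
    have h1 := hZ.indep.precomp (g := fun n : ℤ => -n - 1) fun a b h => by simpa using h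
    have h2 := h1.comp (fun _ v => (-v).swap) fun _ => Measurable.of_discrete
    convert h2 using 2 with n
    funext ω
    simp only [Function.comp, BipolarMap.rev, neg_sub, sub_add_cancel, neg_add, ← sub_eq_add_neg]
    rfl
  uniform n v hv := by
    have h := hZ.uniform (-n - 1) (-v.swap) (by
      simp only [Finset.mem_insert, Finset.mem_singleton] at hv ⊢
      rcases hv with rfl | rfl | rfl <;> simp)
    rw [← h]
    congr 1
    ext ω
    simp only [BipolarMap.rev, Set.mem_ofPred_eq, Prod.ext_iff, Prod.fst_sub, Prod.snd_sub,
      Prod.fst_swap, Prod.snd_swap, sub_add_cancel, Prod.fst_neg, Prod.snd_neg, neg_add,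
      ← sub_eq_add_neg]
    omega

variable [IsProbabilityMeasure P]

/-- The chain absorbed at height `0` is still positive at time `N` with probability at most `M / S +
24 S² / N`, which is made small by choosing first `S`, then `N`. -/
lemma IsEncodingWalk.ae_exists_le (hZ : IsEncodingWalk P Z) {c : ℤ × ℤ →+ ℤ}
    (hc : ∀ f : ℤ → ℝ, f (c (1, 0)) + f (c (0, -1)) + f (c (-1, 1)) = f 1 + f 0 + f (-1))
    (n : ℤ) (M : ℕ) : ∀ᵐ ω ∂P, ∃ k, n ≤ k ∧ c (Z k ω) ≤ c (Z n ω) - M := by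
  let X : ℕ → Ω → ℤ := fun k ω => Nat.rec (M : ℤ)
    (fun k x => absorb c (Z (n + k + 1) ω - Z (n + k) ω) x) k
  have hX0 : ∀ ω, X 0 ω = M := fun _ => rfl
  have hX : ∀ k ω, X (k + 1) ω = absorb c (Z (n + k + 1) ω - Z (n + k) ω) (X k ω) :=
    fun _ _ => rfl
  -- While the chain is positive it is the true height above the target level.
  have hval : ∀ k ω, 0 < X k ω ∧ X k ω = M + c (Z (n + k) ω) - c (Z n ω) ∨
      ∃ k, n ≤ k ∧ c (Z k ω) ≤ c (Z n ω) - M := by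
    intro k ω
    induction k with
    | zero =>
      rcases Nat.eq_zero_or_pos M with rfl | hM
      · exact .inr ⟨n, le_rfl, by simp⟩
      · exact .inl (by simp [hX0, hM])
    | succ k ih =>
      rcases ih with ⟨h1, h2⟩ | h
      · have h3 := hX k ω
        rw [absorb, if_pos h1, map_sub, h2, add_assoc n] at h3
        by_cases h4 : 0 < X (k + 1) ω
        · refine .inl ⟨h4, ?_⟩
          push_cast
          rw [h3]
          ring
        · exact .inr ⟨n + (k + 1), by omega, by omega⟩
      · exact .inr h
  have hbound : ∀ ε : ℝ, 0 < ε →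
      P {ω | ¬ ∃ k, n ≤ k ∧ c (Z k ω) ≤ c (Z n ω) - M} ≤ ENNReal.ofReal ε := by
    intro ε hε
    obtain ⟨S, hS1, hS⟩ : ∃ S : ℝ, 1 ≤ S ∧ (M : ℝ) / S ≤ ε / 2 := by
      refine ⟨max 1 (2 * M / ε), le_max_left _ _, ?_⟩
      rw [div_le_iff₀ (lt_max_of_lt_left one_pos)]
      calc (M : ℝ) = ε / 2 * (2 * M / ε) := by field_simp
        _ ≤ _ := by gcongr; exact le_max_right _ _
    obtain ⟨N, hN⟩ := exists_nat_gt (48 * S ^ 2 / ε)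
    have hNr : (0 : ℝ) < N := lt_of_le_of_lt (by positivity) hN
    have hN0 : 0 < N := by exact_mod_cast hNr
    have hNS : 24 * S ^ 2 / N ≤ ε / 2 := by
      rw [div_lt_iff₀ hε] at hN
      rw [div_le_iff₀ hNr]
      linarith
    have := hZ.measure_chain_le (F := absorb c) (a := n) (X := X) (B := {x | 0 < x}) (N := N)
      (G := absorbBound S N) (measurable_const (a := (M : ℤ))) hX
      (fun v _ x hx => by
        have : ¬ 0 < x := hx
        simpa only [absorb, if_neg this, Set.mem_ofPred_eq]) hN0
      (fun x _ => absorbBound_nonneg (by linarith) hNr.le x)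
      (fun x _ v _ => absorbBound_nonneg (by linarith) hNr.le _)
      (fun x hx h1 => stepMean_absorbBound_le hc hS1 hNr hx h1)
    refine (measure_mono fun ω hω => ?_).trans (this.trans ?_)
    · exact ((hval N ω).resolve_right hω).1
    · calc ∫⁻ ω, ENNReal.ofReal (min 1 (absorbBound S N (X 0 ω))) ∂P
          ≤ ∫⁻ ω, ENNReal.ofReal ε ∂P := by
            refine lintegral_mono fun ω => ENNReal.ofReal_le_ofReal ?_
            refine (min_le_right _ _).trans ((absorbBound_le hNr (by simp [hX0])).trans ?_)
            rw [hX0]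
            push_cast
            linarith
        _ = ENNReal.ofReal ε := by simp
  rw [ae_iff]
  refine le_antisymm (ENNReal.le_of_forall_pos_le_add fun ε hε _ => ?_) zero_le
  rw [zero_add]
  exact (hbound ε hε).trans_eq (by simp)

lemma IsEncodingWalk.ae_exists_lt (hZ : IsEncodingWalk P Z) :
    ∀ᵐ ω ∂P, ∀ n b, (∃ k, n ≤ k ∧ (Z k ω).1 < b) ∧ ∃ k, n ≤ k ∧ (Z k ω).2 < b := by
  have h1 : ∀ᵐ ω ∂P, ∀ (n : ℤ) (M : ℕ), ∃ k, n ≤ k ∧ (Z k ω).1 ≤ (Z n ω).1 - M :=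
    ae_all_iff.2 fun n => ae_all_iff.2 fun M =>
      hZ.ae_exists_le (c := AddMonoidHom.fst ℤ ℤ) (fun f => by simp) n M
  have h2 : ∀ᵐ ω ∂P, ∀ (n : ℤ) (M : ℕ), ∃ k, n ≤ k ∧ (Z k ω).2 ≤ (Z n ω).2 - M :=
    ae_all_iff.2 fun n => ae_all_iff.2 fun M =>
      hZ.ae_exists_le (c := AddMonoidHom.snd ℤ ℤ) (fun f => by simp; ring) n M
  filter_upwards [h1, h2] with ω h1 h2 n b
  obtain ⟨k, hk, h1⟩ := h1 n ((Z n ω).1 - b + 1).toNat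
  obtain ⟨j, hj, h2⟩ := h2 n ((Z n ω).2 - b + 1).toNat
  exact ⟨⟨k, hk, by omega⟩, ⟨j, hj, by omega⟩⟩

lemma IsEncodingWalk.ae_isGoodWalk (hZ : IsEncodingWalk P Z) :
    ∀ᵐ ω ∂P, IsGoodWalk fun n => Z n ω := by
  filter_upwards [ae_all_iff.2 hZ.ae_step, hZ.ae_exists_lt, hZ.rev.ae_exists_lt] with ω h1 h2 h3
  refine ⟨h1, fun n b => (h2 n b).1, fun n b => (h2 n b).2, fun n b => ?_, fun n b => ?_⟩
  -- The half-turn swaps the coordinates, so the past of the first one is the future of the second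
  -- one of the reversed walk.
  · obtain ⟨k, hk, h⟩ := (h3 (-n) b).2
    exact ⟨-k, by omega, h⟩
  · obtain ⟨k, hk, h⟩ := (h3 (-n) b).1
    exact ⟨-k, by omega, h⟩

/-! ### Flow lines merge -/

/-- Each step adds `2 / 3` to the mean square; the cruder increment `1` suffices. -/
lemma IsEncodingWalk.lintegral_northPath_sq (hZ : IsEncodingWalk P Z) (i : ℤ) (k : ℕ) :
    ∫⁻ ω, ENNReal.ofReal ((northPath (fun n => Z n ω) i (i + k) : ℝ) ^ 2) ∂P ≤ k := by
  induction k with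
  | zero => simp [northPath_self]
  | succ k ih =>
    have e : ∀ ω, northPath (fun n => Z n ω) i (i + (k + 1 : ℕ)) =
        move (Z (i + k + 1) ω - Z (i + k) ω) (northPath (fun n => Z n ω) i (i + k)) := fun ω => by
      push_cast
      rw [← add_assoc]
      exact northPath_succ (fun n => Z n ω) (by omega)
    simp only [e]
    rw [hZ.lintegral_step (measurable_northPath Z i k rfl)
      (f := fun x v => ((move v x : ℤ) : ℝ) ^ 2) (fun _ _ => sq_nonneg _)]
    calc _ ≤ ∫⁻ ω, (ENNReal.ofReal ((northPath (fun n => Z n ω) i (i + k) : ℝ) ^ 2) + 1) ∂P := by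
          refine lintegral_mono fun ω => ?_
          rw [stepMean_move (fun x => (x : ℝ) ^ 2), ← ENNReal.ofReal_one,
            ← ENNReal.ofReal_add (sq_nonneg _) zero_le_one]
          refine ENNReal.ofReal_le_ofReal ?_
          push_cast
          linarith
      _ = ∫⁻ ω, ENNReal.ofReal ((northPath (fun n => Z n ω) i (i + k) : ℝ) ^ 2) ∂P + 1 := by
          rw [lintegral_add_right _ measurable_const]
          simp
      _ ≤ k + 1 := by gcongr
      _ = _ := by push_cast; rfl

lemma IsEncodingWalk.measure_northPath_ge (hZ : IsEncodingWalk P Z) (i : ℤ) (k : ℕ) {K : ℝ}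
    (hK : 0 < K) : P {ω | K < |(northPath (fun n => Z n ω) i (i + k) : ℝ)|} ≤
      ENNReal.ofReal (k / K ^ 2) := by
  have hK2 : 0 < K ^ 2 := by positivity
  have hm : Measurable fun ω => northPath (fun n => Z n ω) i (i + k) :=
    (measurable_northPath Z i k rfl).mono (hZ.stepsBefore_le _) le_rfl
  have hm' : Measurable fun ω =>
      ENNReal.ofReal ((northPath (fun n => Z n ω) i (i + k) : ℝ) ^ 2) :=
    (Measurable.of_discrete (f := fun x : ℤ => ENNReal.ofReal ((x : ℝ) ^ 2))).comp hm
  calc _ ≤ P {ω | ENNReal.ofReal (K ^ 2) ≤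
        ENNReal.ofReal ((northPath (fun n => Z n ω) i (i + k) : ℝ) ^ 2)} := by
        refine measure_mono fun ω hω => ENNReal.ofReal_le_ofReal ?_
        rw [← sq_abs (northPath (fun n => Z n ω) i (i + k) : ℝ)]
        have : K < |(northPath (fun n => Z n ω) i (i + k) : ℝ)| := hω
        gcongr
    _ ≤ _ := meas_ge_le_lintegral_div hm'.aemeasurable (by simpa using hK.ne') (by simp)
    _ ≤ (k : ENNReal) / ENNReal.ofReal (K ^ 2) := by
        gcongr
        exact hZ.lintegral_northPath_sq i k
    _ = _ := by rw [ENNReal.ofReal_div_of_pos hK2, ENNReal.ofReal_natCast]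

/-- At time `i + k` the second line is at `0`. The first term is Chebyshev's bound for the first
line being farther than `K`; otherwise `mergeBound_le` applies. -/
lemma IsEncodingWalk.measure_northPath_ne_le (hZ : IsEncodingWalk P Z) (i : ℤ) (k : ℕ) {N : ℕ}
    (hN : 0 < N) {S K : ℝ} (hS : 1 ≤ S) (hK : 0 < K) :
    P {ω | northPath (fun n => Z n ω) i (i + k + N) ≠
      northPath (fun n => Z n ω) (i + k) (i + k + N)} ≤
    ENNReal.ofReal (k / K ^ 2) + ENNReal.ofReal (gapFun S (K + 1) / S + 24 * S ^ 2 / N) := by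
  have hNr : (0 : ℝ) < N := by exact_mod_cast hN
  have hS0 : 0 < S := by linarith
  let p : Ω → ℤ → ℤ := fun ω => northPath (fun n => Z n ω) i
  let q : Ω → ℤ → ℤ := fun ω => northPath (fun n => Z n ω) (i + k)
  have hp : ∀ ω (n : ℕ), p ω (i + k + (n + 1 : ℕ)) =
      move (Z (i + k + n + 1) ω - Z (i + k + n) ω) (p ω (i + k + n)) := fun ω n => by
    push_cast
    rw [← add_assoc]
    exact northPath_succ (fun n => Z n ω) (by omega)
  have hq : ∀ ω (n : ℕ), q ω (i + k + (n + 1 : ℕ)) =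
      move (Z (i + k + n + 1) ω - Z (i + k + n) ω) (q ω (i + k + n)) := fun ω n => by
    push_cast
    rw [← add_assoc]
    exact northPath_succ (fun n => Z n ω) (by omega)
  have hq0 : ∀ ω, q ω (i + k) = 0 := fun ω => northPath_self _ _
  -- The pair is ordered once, at time `i + k`; admissible steps preserve the order since `move` is
  -- monotone.
  let X : ℕ → Ω → ℤ × ℤ := fun n ω => if p ω (i + k) ≤ 0 then
    (p ω (i + k + n), q ω (i + k + n)) else (q ω (i + k + n), p ω (i + k + n))
  have hX0 : ∀ ω, X 0 ω = (min (p ω (i + k)) 0, max (p ω (i + k)) 0) := by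
    intro ω
    simp only [X, Nat.cast_zero, add_zero, hq0]
    split_ifs with h
    · rw [min_eq_left h, max_eq_right h]
    · rw [min_eq_right (not_le.1 h).le, max_eq_left (not_le.1 h).le]
  have hX : ∀ n ω, X (n + 1) ω = (fun (v : ℤ × ℤ) (x : ℤ × ℤ) => (move v x.1, move v x.2))
      (Z (i + k + n + 1) ω - Z (i + k + n) ω) (X n ω) := by
    intro n ω
    simp only [X, hp, hq]
    split_ifs <;> rfl
  have hX0m : Measurable[stepsBefore Z (i + k)] (X 0) := by
    rw [funext hX0]
    exact (Measurable.of_discrete (f := fun a : ℤ => (min a 0, max a 0))).comp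
      (measurable_northPath Z i k rfl)
  have hle : ∀ᵐ ω ∂P, ∀ n, (X n ω).1 ≤ (X n ω).2 := by
    filter_upwards [ae_all_iff.2 hZ.ae_step] with ω hω n
    induction n with
    | zero => rw [hX0]; exact min_le_max
    | succ n ih => rw [hX]; exact move_le_move (hω _) ih
  have hchain := hZ.measure_chain_le hX0m hX (B := {x | x.1 < x.2})
    (fun v hv x hx => not_lt.2 (move_le_move hv (not_lt.1 hx))) hN (G := mergeBound S N)
    (fun x hx => mergeBound_nonneg hS0.le hNr.le (le_of_lt hx))
    (fun x hx v hv => mergeBound_nonneg hS0.le hNr.le (move_le_move hv (le_of_lt hx)))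
    (fun x hx h1 => stepMean_mergeBound_le hS hNr hx h1)
  have hmp : Measurable fun ω => p ω (i + k) :=
    (measurable_northPath Z i k rfl).mono (hZ.stepsBefore_le _) le_rfl
  have hms : MeasurableSet {ω | K < |(p ω (i + k) : ℝ)|} :=
    hmp (MeasurableSet.of_discrete (s := {x : ℤ | K < |(x : ℝ)|}))
  calc _ ≤ P {ω | (X N ω).1 < (X N ω).2} := by
        refine measure_mono_ae ?_
        filter_upwards [hle] with ω hω hne
        refine lt_of_le_of_ne (hω N) fun heq => hne ?_
        simp only [X] at heq
        split_ifs at heq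
        · exact heq
        · exact heq.symm
    _ ≤ _ := hchain
    _ ≤ ∫⁻ ω, ({ω | K < |(p ω (i + k) : ℝ)|}.indicator 1 ω +
          ENNReal.ofReal (gapFun S (K + 1) / S + 24 * S ^ 2 / N)) ∂P := by
        refine lintegral_mono fun ω => ?_
        by_cases h : K < |(p ω (i + k) : ℝ)|
        · rw [Set.indicator_of_mem (show ω ∈ {ω | K < |(p ω (i + k) : ℝ)|} from h)]
          refine le_trans ?_ le_self_add
          rw [Pi.one_apply, ← ENNReal.ofReal_one]
          exact ENNReal.ofReal_le_ofReal (min_le_left _ _)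
        · refine le_trans ?_ le_add_self
          refine ENNReal.ofReal_le_ofReal ((min_le_right _ _).trans ?_)
          rw [hX0]
          exact mergeBound_le hS0 hNr (not_lt.1 h)
    _ ≤ _ := by
        rw [lintegral_add_right _ measurable_const, lintegral_indicator_one hms]
        simp only [lintegral_const, measure_univ, mul_one]
        gcongr
        exact hZ.measure_northPath_ge i k hK

/-- Both `K` and `√(S * K)` are at most `t * S`, and `25 = 1 + 24`. -/
lemma gapFun_div_le {S K t : ℝ} (hS : 0 < S) (ht : t ≤ 1) (h : K ≤ t ^ 2 * S)
    (ht0 : 0 ≤ t) : gapFun S K / S ≤ 25 * t := by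
  have h1 : √(S * K) ≤ t * S := Real.sqrt_le_iff.2 ⟨by positivity, by nlinarith⟩
  have h2 : K ≤ t * S := h.trans (by nlinarith [mul_nonneg (mul_nonneg ht0 (sub_nonneg.2 ht)) hS.le])
  rw [div_le_iff₀ hS, gapFun]
  linarith

/-- On the scale of the time between their starting points, two flow lines merge quickly. -/
lemma exists_merge_time (c : ℝ) {ε : ℝ} (hε : 0 < ε) : ∃ B : ℕ, 0 < B ∧
    ∀ {Z : ℤ → Ω → ℤ × ℤ}, IsEncodingWalk P Z → ∀ (m : ℕ), 1 ≤ m → ∀ (i : ℤ) (k : ℕ),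
    (k : ℝ) ≤ c * m → P {ω | northPath (fun n => Z n ω) i (i + k + (B * m : ℕ)) ≠
      northPath (fun n => Z n ω) (i + k) (i + k + (B * m : ℕ))} ≤ ENNReal.ofReal ε := by
  -- The error `ε` is split in three: `A` controls the distance at the start, `t` the gap term, `B`
  -- the time term.
  obtain ⟨A, hA1, hA⟩ : ∃ A : ℝ, 1 ≤ A ∧ c / A ^ 2 ≤ ε / 3 := by
    refine ⟨max 1 (3 * c / ε), le_max_left _ _, ?_⟩
    have h1 : 1 ≤ max 1 (3 * c / ε) := le_max_left _ _
    have h2 : 3 * c / ε ≤ max 1 (3 * c / ε) := le_max_right _ _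
    rw [div_le_iff₀ hε] at h2
    rw [div_le_iff₀ (by positivity)]
    nlinarith [mul_nonneg hε.le (mul_nonneg (sub_nonneg.2 h1) (zero_le_one.trans h1))]
  obtain ⟨t, ht0, ht1, ht⟩ : ∃ t : ℝ, 0 < t ∧ t ≤ 1 ∧ 25 * t ≤ ε / 3 :=
    ⟨min 1 (ε / 75), lt_min one_pos (by positivity), min_le_left _ _, by
      have := min_le_right 1 (ε / 75)
      linarith⟩
  have hM1 : 1 ≤ (A + 1) / t ^ 2 := by
    rw [one_le_div (by positivity)]
    nlinarith
  -- With this `M`, `A * √m + 1 ≤ (A + 1) * √m = t ^ 2 * (M * √m)`, as `gapFun_div_le` requires. All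
  -- powers of `m` then cancel.
  obtain ⟨M, hM⟩ : ∃ M, M = (A + 1) / t ^ 2 := ⟨_, rfl⟩
  have hAM : A + 1 = t ^ 2 * M := by
    rw [hM]
    field_simp
  rw [← hM] at hM1
  obtain ⟨B, hB⟩ := exists_nat_gt (72 * M ^ 2 / ε)
  have hBr : (0 : ℝ) < B := lt_of_le_of_lt (by positivity) hB
  rw [div_lt_iff₀ hε] at hB
  refine ⟨B, by exact_mod_cast hBr, fun {Z} hZ m hm i k hk => ?_⟩
  have hmr : (1 : ℝ) ≤ m := by exact_mod_cast hm
  have hm0 : (0 : ℝ) < m := by linarith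
  have hsq := Real.sq_sqrt hm0.le
  have hsq1 : 1 ≤ √(m : ℝ) := Real.one_le_sqrt.2 hmr
  have hBm : 0 < B * m := Nat.mul_pos (by exact_mod_cast hBr) (by omega)
  have hA0 : 0 < A := by linarith
  have hM0 : 0 < M := by linarith
  refine (hZ.measure_northPath_ne_le i k hBm (S := M * √m) (K := A * √m)
    (one_le_mul_of_one_le_of_one_le hM1 hsq1) (by positivity)).trans ?_
  have h1 : (k : ℝ) / (A * √m) ^ 2 ≤ ε / 3 := by
    refine le_trans ?_ hA
    rw [mul_pow, hsq, div_le_div_iff₀ (by positivity) (by positivity)]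
    nlinarith [mul_le_mul_of_nonneg_right hk (sq_nonneg A)]
  have h2 : gapFun (M * √m) (A * √m + 1) / (M * √m) ≤ ε / 3 := by
    refine (gapFun_div_le (by positivity) ht1 ?_ ht0.le).trans ht
    rw [← mul_assoc, ← hAM]
    linarith
  have h3 : 24 * (M * √m) ^ 2 / ((B * m : ℕ) : ℝ) ≤ ε / 3 := by
    push_cast
    rw [mul_pow, hsq, div_le_iff₀ (by positivity)]
    nlinarith
  rw [← ENNReal.ofReal_add (by positivity) (by unfold gapFun; positivity)]
  exact ENNReal.ofReal_le_ofReal (by linarith)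

/-! ### Tightness -/

lemma floor_sub_floor {s₁ s₂ : ℝ} (hs : s₁ < s₂) {m : ℕ} (hm : 1 ≤ m) :
    ∃ k : ℕ, ⌊s₂ * (m : ℝ)⌋ = ⌊s₁ * (m : ℝ)⌋ + k ∧ (k : ℝ) ≤ (s₂ - s₁ + 1) * m := by
  have hmr : (1 : ℝ) ≤ m := by exact_mod_cast hm
  have hle : ⌊s₁ * (m : ℝ)⌋ ≤ ⌊s₂ * (m : ℝ)⌋ := Int.floor_le_floor (by gcongr)
  obtain ⟨k, hk⟩ := Int.le.dest hle
  refine ⟨k, hk.symm, ?_⟩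
  have h1 := Int.floor_le (s₂ * (m : ℝ))
  have h2 := Int.lt_floor_add_one (s₁ * (m : ℝ))
  rw [← hk] at h1
  push_cast at h1
  linarith

lemma finite_and_ncard_le {s : Set ℤ} {a b : ℤ} {n : ℕ} (h : s ⊆ Set.Ico a b) (hn : b - a ≤ n) :
    s.Finite ∧ s.ncard ≤ n := by
  refine ⟨(Set.finite_Ico a b).subset h, (Set.ncard_le_ncard h (Set.finite_Ico a b)).trans ?_⟩
  rw [← Finset.coe_Ico, Set.ncard_coe_finset, Int.card_Ico]
  omega

lemma IsEncodingWalk.tight_MN (hZ : IsEncodingWalk P Z) {s₁ s₂ : ℝ} (hs : s₁ < s₂) :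
    TightRescaledCard P
      (fun m ω => MN (fun n => Z n ω) ⌊s₁ * (m : ℝ)⌋ ⌊s₂ * (m : ℝ)⌋) := by
  refine tightRescaledCard_of_bound (fun m => ?_) fun ε hε => ?_
  · exact (measurable_ncard fun e => measurable_mem_MN _ _ e).comp hZ.measurable_walk
  · obtain ⟨B, -, hB⟩ := exists_merge_time (P := P) (s₂ - s₁ + 1) hε
    refine ⟨B, fun m hm => ?_⟩
    obtain ⟨k, hk, hkm⟩ := floor_sub_floor hs hm
    refine (measure_mono_ae ?_).trans (hB hZ m hm ⌊s₁ * (m : ℝ)⌋ k hkm)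
    filter_upwards [hZ.ae_isGoodWalk] with ω hω hn
    intro heq
    refine hn ?_
    rw [hk]
    exact finite_and_ncard_le (MN_subset hω (by omega) (by omega) heq) (by omega)

lemma IsEncodingWalk.tight_MS (hZ : IsEncodingWalk P Z) {s₁ s₂ : ℝ} (hs : s₁ < s₂) :
    TightRescaledCard P
      (fun m ω => MS (fun n => Z n ω) ⌊s₁ * (m : ℝ)⌋ ⌊s₂ * (m : ℝ)⌋) := by
  refine tightRescaledCard_of_bound (fun m => ?_) fun ε hε => ?_
  · exact (measurable_ncard fun e => measurable_mem_MS _ _ e).comp hZ.measurable_walk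
  · obtain ⟨B, -, hB⟩ := exists_merge_time (P := P) (s₂ - s₁ + 1) hε
    refine ⟨B, fun m hm => ?_⟩
    obtain ⟨k, hk, hkm⟩ := floor_sub_floor hs hm
    -- In reversed time the line from the later index starts first, at `-⌊s₂ * m⌋`.
    refine (measure_mono_ae ?_).trans (hB hZ.rev m hm (-⌊s₂ * (m : ℝ)⌋) k hkm)
    filter_upwards [hZ.ae_isGoodWalk] with ω hω hn
    intro heq
    refine hn ?_
    have e : -⌊s₂ * (m : ℝ)⌋ + k = -⌊s₁ * (m : ℝ)⌋ := by omega
    rw [e] at heq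
    have hsub := MS_subset hω (by omega) (by omega) heq
    refine finite_and_ncard_le (b := ⌊s₁ * (m : ℝ)⌋ + 1)
      (hsub.trans fun x hx => ⟨Int.add_one_le_iff.2 hx.1, Int.lt_add_one_iff.2 hx.2⟩) (by omega)

end Walk

end BipolarMap

theorem mainTheorem7 {Ω : Type*} [MeasurableSpace Ω] (P : Measure Ω) [IsProbabilityMeasure P]
    (Z : ℤ → Ω → ℤ × ℤ) (hZ : BipolarMap.IsEncodingWalk P Z) (s₁ s₂ : ℝ) (hs : s₁ < s₂) :
    BipolarMap.TightRescaledCard P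
        (fun m ω => BipolarMap.MN (fun n => Z n ω) ⌊s₁ * (m : ℝ)⌋ ⌊s₂ * (m : ℝ)⌋) ∧
      BipolarMap.TightRescaledCard P
        (fun m ω => BipolarMap.MS (fun n => Z n ω) ⌊s₁ * (m : ℝ)⌋ ⌊s₂ * (m : ℝ)⌋) :=
  ⟨hZ.tight_MN hs, hZ.tight_MS hs⟩
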